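/- Let $\omega=\{0,1,2,\dots\}$ be discrete, let $\mathbb{M}=\omega\times[0,1]$ be the topological sum of countably many copies of the unit interval, and let $\beta q:\beta\mathbb{M}\to\beta\omega$ be the extension of the projection $q(n,x)=n$ to the Čech–Stone compactifications, where $\beta\omega$ is the space of ultrafilters on $\omega$. For a free ultrafilter $u\in\omega^*=\beta\omega\setminus\omega$ let $\mathbb{I}_u=(\beta q)^{-1}(u)$ (a *standard subcontinuum*), and let $0_u=u\text{-}\lim_n (n,0)\in\mathbb{I}_u$. A *subcontinuum* of $\mathbb{I}_u$ is a nonempty closed connected subset. For $x,y\in\mathbb{I}_u$ write $x\le_u y$ if every subcontinuum of $\mathbb{I}_u$ that contains $0_u$ and $y$ also contains $x$; write $x<_u y$ if $x\le_u y$ and not $y\le_u x$. The *layer* of $x\in\mathbb{I}_u$ is $\{y\in\mathbb{I}_u: y\le_u x\text{ and }x\le_u y\}$. A *cut point* of $\mathbb{I}_u$ is a point $p\in\mathbb{I}_u$ such that $\mathbb{I}_u\setminus\{p\}$ is disconnected. **Theorem.** Assume the Continuum Hypothesis. Let $u\in\omega^*$ and let $(a_n)_{n\in\omega}$ be a strictly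 increasing sequence (with respect to $<_u$) of cut points of $\mathbb{I}_u$. Then the sequence has a least upper bound in $\mathbb{I}_u$ with respect to the preorder $\le_u$; all its least upper bounds have the same layer $L$ (the supremum layer of the sequence); and $L$ is homeomorphic to $\mathbb{H}^*=\beta\mathbb{H}\setminus\mathbb{H}$, where $\mathbb{H}=[0,\infty)$. -/

import Mathlib

open Set Topology unitInterval
open scoped NNReal

noncomputable section

namespace StandardContinuum

/-- The Čech-Stone remainder `X* = βX \ X`, as a subset of `βX`. -/
def remainder (X : Type*) [TopologicalSpace X] : Set (StoneCech X) :=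
  (range (stoneCechUnit : X → StoneCech X))ᶜ

/-- The space `𝕄 = ω × [0,1]`, the topological sum of countably many copies of the
unit interval. -/
abbrev Mspace : Type := ℕ × I

/-- The extension `βq : β𝕄 → βω` of the projection `q (n, x) = n`, where `βω` is
the space of all ultrafilters on `ℕ`. -/
def betaProj : StoneCech Mspace → Ultrafilter ℕ :=
  stoneCechExtend (g := fun p : Mspace => (pure p.1 : Ultrafilter ℕ))
    (continuous_of_discreteTopology.comp continuous_fst)

/-- The fiber `𝕀_u` of `u` under `βq`; for a free ultrafilter `u` this is the standard
subcontinuum given by `u`. -/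
def fiber (u : Ultrafilter ℕ) : Set (StoneCech Mspace) := {p | betaProj p = u}

/-- The bottom point `0_u`, the limit along `u` of the points `(n, 0)`
(the extension to `βω` of `n ↦ (n, 0)`, evaluated at `u`). -/
def bottom (u : Ultrafilter ℕ) : StoneCech Mspace :=
  Ultrafilter.extend (fun n : ℕ => stoneCechUnit ((n, 0) : Mspace)) u

/-- `K` is a subcontinuum of `𝕀_u`: a closed (hence compact), connected, nonempty subset. -/
def IsSubcontinuum (u : Ultrafilter ℕ) (K : Set (StoneCech Mspace)) : Prop :=
  K ⊆ fiber u ∧ IsClosed K ∧ IsConnected K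

/-- The preorder `x ≤_u y` (for points of `𝕀_u`): every subcontinuum of `𝕀_u` that contains
`0_u` and `y` also contains `x`. -/
def le (u : Ultrafilter ℕ) (x y : StoneCech Mspace) : Prop :=
  ∀ K, IsSubcontinuum u K → bottom u ∈ K → y ∈ K → x ∈ K

/-- The strict relation `x <_u y`. -/
def lt (u : Ultrafilter ℕ) (x y : StoneCech Mspace) : Prop :=
  le u x y ∧ ¬ le u y x

/-- The layer of `x` in `𝕀_u`. -/
def layer (u : Ultrafilter ℕ) (x : StoneCech Mspace) : Set (StoneCech Mspace) :=
  {y | y ∈ fiber u ∧ le u y x ∧ le u x y}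

/-- `p` is a cut point of `𝕀_u`: a point of `𝕀_u` whose removal disconnects `𝕀_u`. -/
def IsCutPoint (u : Ultrafilter ℕ) (p : StoneCech Mspace) : Prop :=
  p ∈ fiber u ∧ ¬ IsPreconnected (fiber u \ {p})

/-- `L` is the supremum layer of the sequence `a`: the layer of a least upper bound of the
sequence in `𝕀_u` with respect to `≤_u`. -/
def IsSupremumLayer (u : Ultrafilter ℕ) (a : ℕ → StoneCech Mspace)
    (L : Set (StoneCech Mspace)) : Prop :=
  ∃ x ∈ fiber u, (∀ n, le u (a n) x) ∧
    (∀ y ∈ fiber u, (∀ n, le u (a n) y) → le u x y) ∧ L = layer u x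

end StandardContinuum

end

/-!
The cut points enter only through the points between them: if `x <_u y`, a Urysohn function for a
subcontinuum that separates `y` from `0_u` and `x` yields a standard point, the `u`-limit of some
`(n, z n)`, between `x` and `y` (`exists_lower_of_lt`). So there are functions `z 0, z 1, …` on `ω`
whose standard points interleave with the sequence, and the least upper bounds of the sequence form
the set `limitLayer u z` of the points above all `z k` and below every standard point that is above
all `z k`; this set is a single layer (`exists_isSupremumLayer_iff`).

A continuous function on `β𝕄` gives, by restriction to the segments from `z k m` to `z (k + 1) m`
and rescaling, a double sequence `g k m` in `C(I, I)`. Its values on the limit layer are the values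
that are approximated by `g k m` for infinitely many `k` and `u`-almost all `m`. Likewise the values
on `ℍ*` of a function on `βℍ` are governed by the sequence `f k` of its restrictions to the
intervals `[k, k + 1]`. So the two spaces are compared through families of sequences and double
sequences in `C(I, I)`.

The Continuum Hypothesis is used for a back-and-forth construction of length `ω₁`. It pairs all
sequences `f` with double sequences `g`, and conversely, so that every first-order statement about
finitely many of the `f k` is, for all but finitely many `k`, equivalent to the same statement about
the `g k m` for `u`-almost all `m` (`exists_almostElementary`). An element can be added to a
countable stage by treating the indices `k` one at a time: at `k`, a finite number of formulas,
growing to infinity with `k`, is taken care of (`exists_extension_at`), and no saturation of an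
ultrapower is needed. The language contains the statements "finitely many maps simultaneously take
values in given rational intervals at some point", hence paired functions have the same cluster
values on the two spaces. It also contains the corresponding statements at the end points of `I`.
Hence, if the members of a sequence fit together at the end points, then those of its
partner nearly do so, and can be glued to a continuous function (`exists_glued`,
`exists_glued_Mspace`). So all continuous functions take part in the pairing, and both
spaces are embedded by the paired functions onto the same closed subset of a Tychonoff cube
(`nonempty_homeomorph_of_approx`).
-/

noncomputable section

namespace StandardContinuum

open Filter

/-! ### Back and forth between sequences and double sequences -/

section BackAndForth

variable (L : FirstOrder.Language.{0, 0}) {A : Type} [L.Structure A] (u : Ultrafilter ℕ)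

/-- A family of pairs, each consisting of a sequence `f` in `A` and a double sequence `g` in `A`,
is almost elementary if, for every `L`-definable relation and all but finitely many `k`, the
relation holds for the `f k` if and only if it holds for the `g k m` with `u`-almost all `m`. -/
def AlmostElementary {T : Type} (F : T → (ℕ → A) × (ℕ → ℕ → A)) : Prop :=
  ∀ S : Set (T → A), (∅ : Set A).Definable L S → ∀ᶠ k in atTop,
    ((fun i => (F i).1 k) ∈ S ↔ ∀ᶠ m in (u : Filter ℕ), (fun i => (F i).2 k m) ∈ S)

variable {L u}

theorem AlmostElementary.comp {T T' : Type} {F : T → (ℕ → A) × (ℕ → ℕ → A)}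
    (hF : AlmostElementary L u F) (e : T' → T) : AlmostElementary L u (F ∘ e) :=
  fun S hS => hF ((fun v => v ∘ e) ⁻¹' S) (hS.preimage_comp e)

/-- A first-order formula has finitely many free variables. -/
theorem exists_finset_definable {T : Type} {S : Set (T → A)}
    (hS : (∅ : Set A).Definable L S) : ∃ (T₀ : Finset T) (S₀ : Set (T₀ → A)),
      (∅ : Set A).Definable L S₀ ∧ S = (fun v => v ∘ (Subtype.val : T₀ → T)) ⁻¹' S₀ := by
  classical
  obtain ⟨φ, rfl⟩ := Set.empty_definable_iff.1 hS
  refine ⟨φ.freeVarFinset, _, Set.empty_definable_iff.2 ⟨φ.restrictFreeVar id, rfl⟩, ?_⟩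
  ext v
  exact (FirstOrder.Language.BoundedFormula.realize_restrictFreeVar v (by simp)).symm

theorem AlmostElementary.of_finset {T : Type} {F : T → (ℕ → A) × (ℕ → ℕ → A)}
    (hF : ∀ T₀ : Finset T, AlmostElementary L u (fun i : T₀ => F i)) :
    AlmostElementary L u F := by
  intro S hS
  obtain ⟨T₀, S₀, hS₀, rfl⟩ := exists_finset_definable hS
  exact hF T₀ S₀ hS₀

theorem countable_definable [Countable L.Symbols] (T : Type) [Countable T] :
    {S : Set (T → A) | (∅ : Set A).Definable L S}.Countable := by
  have : {S : Set (T → A) | (∅ : Set A).Definable L S} =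
      range (fun φ : L.Formula T => Set.ofPred (φ.Realize (M := A))) := by
    ext S
    rw [Set.mem_ofPred_eq, Set.empty_definable_iff]
    simp [eq_comm]
  rw [this]
  exact countable_range _

/-- The value at `k` of a pair is prescribed in one of its two components. -/
def Meets (w : (ℕ → A) ⊕ (ℕ → ℕ → A)) (k : ℕ) (x : A × (ℕ → A)) : Prop :=
  Sum.elim (fun f => x.1 = f k) (fun g => x.2 = g k) w

/-- The step of the back-and-forth at one index `k`: if the tuples `v` and `v' m` agree on the
projections of all Boolean combinations of `D 0, …, D (N - 1)`, then one more coordinate, given on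
one of the two sides, can be matched so that the longer tuples agree on `D 0, …, D (N - 1)`. -/
theorem exists_extension_at {T : Type} (D : ℕ → Set (T ⊕ Fin 1 → A)) (N : ℕ) (v : T → A)
    (v' : ℕ → T → A)
    (h : ∀ P ⊆ Finset.range N,
      ((∃ x : A, ∀ j < N, (j ∈ P ↔ Sum.elim v (fun _ => x) ∈ D j)) ↔
        ∀ᶠ m in (u : Filter ℕ), ∃ x : A, ∀ j < N, (j ∈ P ↔ Sum.elim (v' m) (fun _ => x) ∈ D j)))
    (w : (ℕ → A) ⊕ (ℕ → ℕ → A)) (k : ℕ) :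
    ∃ x : A × (ℕ → A), Meets w k x ∧ ∀ j < N, (Sum.elim v (fun _ => x.1) ∈ D j ↔
      ∀ᶠ m in (u : Filter ℕ), Sum.elim (v' m) (fun _ => x.2 m) ∈ D j) := by
  classical
  rcases w with f | g
  · -- `P` is the pattern realized by `f k`; matching points for `v' m` are chosen `m` by `m`.
    let P := (Finset.range N).filter (fun j => Sum.elim v (fun _ => f k) ∈ D j)
    have hP := (h P (Finset.filter_subset _ _)).1 ⟨f k, fun j hj => by simp [P, hj]⟩
    have hex : ∃ y : ℕ → A, ∀ᶠ m in (u : Filter ℕ),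
        ∀ j < N, (j ∈ P ↔ Sum.elim (v' m) (fun _ => y m) ∈ D j) := by
      have : Nonempty A := ⟨f k⟩
      refine ⟨fun m => Classical.epsilon fun x =>
        ∀ j < N, (j ∈ P ↔ Sum.elim (v' m) (fun _ => x) ∈ D j), ?_⟩
      filter_upwards [hP] with m hm
      exact Classical.epsilon_spec hm
    obtain ⟨y, hy⟩ := hex
    refine ⟨(f k, y), rfl, fun j hj => ?_⟩
    have hy' : ∀ᶠ m in (u : Filter ℕ), (Sum.elim v (fun _ => f k) ∈ D j ↔
        Sum.elim (v' m) (fun _ => y m) ∈ D j) := by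
      filter_upwards [hy] with m hm
      rw [← hm j hj]
      simp [P, hj]
    rw [← eventually_congr hy', eventually_const]
  · -- As `u` is an ultrafilter, `u`-almost all `g k m` realize one and the same pattern `P`, which
    -- is then realized over `v` by a single point.
    let P := (Finset.range N).filter
      (fun j => ∀ᶠ m in (u : Filter ℕ), Sum.elim (v' m) (fun _ => g k m) ∈ D j)
    have hP : ∀ j < N, ∀ᶠ m in (u : Filter ℕ),
        (j ∈ P ↔ Sum.elim (v' m) (fun _ => g k m) ∈ D j) := by
      intro j hj
      by_cases hjP : ∀ᶠ m in (u : Filter ℕ), Sum.elim (v' m) (fun _ => g k m) ∈ D j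
      · filter_upwards [hjP] with m hm
        simp only [hm, iff_true]
        exact Finset.mem_filter.2 ⟨Finset.mem_range.2 hj, hjP⟩
      · filter_upwards [Ultrafilter.eventually_not.2 hjP] with m hm
        simp only [hm, iff_false]
        exact fun hj' => hjP (Finset.mem_filter.1 hj').2
    have hall := (Set.finite_lt_nat N).eventually_all.2 hP
    obtain ⟨x, hx⟩ := (h P (Finset.filter_subset _ _)).2
      (hall.mono fun m hm => ⟨g k m, fun j hj => hm j hj⟩)
    refine ⟨(x, g k), rfl, fun j hj => ?_⟩
    rw [← hx j hj]
    simp [P, hj]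

/-- A countable almost elementary family can be extended by a pair one of whose components is
prescribed. -/
theorem AlmostElementary.exists_extension [Countable L.Symbols] {T : Type} [Countable T]
    {F : T → (ℕ → A) × (ℕ → ℕ → A)} (hF : AlmostElementary L u F)
    (w : (ℕ → A) ⊕ (ℕ → ℕ → A)) : ∃ x : (ℕ → A) × (ℕ → ℕ → A),
      (∀ k, Meets w k (x.1 k, x.2 k)) ∧
        AlmostElementary L u (Sum.elim F (fun _ : Fin 1 => x)) := by
  classical
  obtain ⟨D, hD⟩ := (countable_definable (L := L) (A := A) (T ⊕ Fin 1)).exists_eq_range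
    ⟨_, Set.definable_univ⟩
  have hDd : ∀ j, (∅ : Set A).Definable L (D j) := fun j => by
    have : D j ∈ range D := mem_range_self j
    rwa [← hD] at this
  -- `B N P` consists of the tuples with an extension that lies in exactly those of
  -- `D 0, …, D (N - 1)` whose index is in `P`.
  let B : ℕ → Finset ℕ → Set (T → A) := fun N P =>
    {v | ∃ x : A, ∀ j < N, (j ∈ P ↔ Sum.elim v (fun _ => x) ∈ D j)}
  have hB : ∀ N P, (∅ : Set A).Definable L (B N P) := by
    intro N P
    have h1 : (∅ : Set A).Definable L
        (⋂ j ∈ Finset.range N, if j ∈ P then D j else (D j)ᶜ) := by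
      refine Set.definable_biInter_finset (fun j => ?_) _
      split_ifs
      exacts [hDd j, (hDd j).compl]
    convert h1.exists_of_finite using 1
    ext v
    constructor
    · rintro ⟨x, hx⟩
      refine ⟨fun _ => x, mem_iInter₂.2 fun j hj => ?_⟩
      have := hx j (Finset.mem_range.1 hj)
      split_ifs with hjP
      exacts [this.1 hjP, fun h => hjP (this.2 h)]
    · rintro ⟨x, hx⟩
      have hx0 : x = fun _ => x 0 := funext fun i => by rw [Subsingleton.elim i 0]
      refine ⟨x 0, fun j hj => ?_⟩
      have := mem_iInter₂.1 hx j (Finset.mem_range.2 hj)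
      rw [← hx0]
      split_ifs at this with hjP
      exacts [iff_of_true hjP this, iff_of_false hjP this]
  let good : ℕ → ℕ → Prop := fun k N => ∀ P ⊆ Finset.range N,
    ((fun i => (F i).1 k) ∈ B N P ↔ ∀ᶠ m in (u : Filter ℕ), (fun i => (F i).2 k m) ∈ B N P)
  have hgood : ∀ N, ∀ᶠ k in atTop, good k N := by
    intro N
    have := ((Finset.range N).powerset.finite_toSet.eventually_all (l := atTop)
      (p := fun P k => ((fun i => (F i).1 k) ∈ B N P ↔
        ∀ᶠ m in (u : Filter ℕ), (fun i => (F i).2 k m) ∈ B N P))).2 (fun P _ => hF _ (hB N P))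
    filter_upwards [this] with k hk P hP
    exact hk P (Finset.mem_coe.2 (Finset.mem_powerset.2 hP))
  -- The number of definable sets that are matched at `k` tends to infinity with `k`.
  let ν : ℕ → ℕ := fun k => Nat.findGreatest (good k) k
  have hstep : ∀ k, ∃ x : A × (ℕ → A), Meets w k x ∧ (good k (ν k) → ∀ j < ν k,
      (Sum.elim (fun i => (F i).1 k) (fun _ => x.1) ∈ D j ↔
        ∀ᶠ m in (u : Filter ℕ), Sum.elim (fun i => (F i).2 k m) (fun _ => x.2 m) ∈ D j)) := by
    intro k
    by_cases hk : good k (ν k)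
    · obtain ⟨x, hx, hx'⟩ := exists_extension_at D (ν k) _ _ hk w k
      exact ⟨x, hx, fun _ => hx'⟩
    · rcases w with f | g
      · exact ⟨(f k, fun _ => f k), rfl, fun h => absurd h hk⟩
      · exact ⟨(g k 0, g k), rfl, fun h => absurd h hk⟩
  choose x hx hx' using hstep
  refine ⟨(fun k => (x k).1, fun k => (x k).2), hx, fun S hS => ?_⟩
  obtain ⟨j, rfl⟩ : S ∈ range D := hD ▸ hS
  filter_upwards [hgood (j + 1), eventually_ge_atTop (j + 1)] with k hk hjk
  have hspec : good k (ν k) := Nat.findGreatest_spec hjk hk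
  have hlt : j < ν k := Nat.lt_of_succ_le (Nat.le_findGreatest hjk hk)
  convert hx' k hspec j hlt using 2
  · ext (i | i) <;> rfl
  · congr! 2 with m
    ext (i | i) <;> rfl

theorem almostElementary_of_isEmpty {T : Type} [IsEmpty T] (F : T → (ℕ → A) × (ℕ → ℕ → A)) :
    AlmostElementary L u F := by
  refine fun S _ => Eventually.of_forall fun k => ?_
  have : ∀ m, (fun i => (F i).2 k m) = fun i => (F i).1 k := fun m => Subsingleton.elim _ _
  simp only [this, eventually_const]

theorem exists_almostElementary_of_wellOrder [Countable L.Symbols] {W : Type} [LinearOrder W]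
    [WellFoundedLT W] (hW : ∀ w : W, (Iio w).Countable)
    (task : W → (ℕ → A) ⊕ (ℕ → ℕ → A)) :
    ∃ F : W → (ℕ → A) × (ℕ → ℕ → A), AlmostElementary L u F ∧
      ∀ w k, Meets (task w) k ((F w).1 k, (F w).2 k) := by
  classical
  by_cases hne : Nonempty W
  swap
  · rw [not_nonempty_iff] at hne
    exact ⟨fun w => isEmptyElim w, almostElementary_of_isEmpty _, fun w => isEmptyElim w⟩
  have hne' : Nonempty ((ℕ → A) × (ℕ → ℕ → A)) := by
    rcases task hne.some with f | g
    · exact ⟨(f, fun k _ => f k)⟩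
    · exact ⟨(fun k => g k 0, g)⟩
  let good : (w : W) → ((v : W) → v < w → (ℕ → A) × (ℕ → ℕ → A)) →
      (ℕ → A) × (ℕ → ℕ → A) → Prop := fun w G x =>
    (∀ k, Meets (task w) k (x.1 k, x.2 k)) ∧
      AlmostElementary L u (Sum.elim (fun v : Iio w => G v v.2) (fun _ : Fin 1 => x))
  let F : W → (ℕ → A) × (ℕ → ℕ → A) :=
    (wellFounded_lt (α := W)).fix fun w G => Classical.epsilon (good w G)
  have hF : ∀ w, F w = Classical.epsilon (good w fun v _ => F v) := fun w =>
    (wellFounded_lt (α := W)).fix_eq _ w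
  have hspec : ∀ w, AlmostElementary L u (fun v : Iio w => F v.1) →
      good w (fun v _ => F v) (F w) := by
    intro w hw
    have : Countable (Iio w) := (hW w).to_subtype
    rw [hF w]
    exact Classical.epsilon_spec (hw.exists_extension (task w))
  have hIic : ∀ w, AlmostElementary L u (fun v : Iio w => F v.1) →
      AlmostElementary L u (fun v : Iic w => F v.1) := by
    intro w hw
    let e : Iic w → Iio w ⊕ Fin 1 := fun v =>
      if h : v.1 < w then Sum.inl ⟨v.1, h⟩ else Sum.inr 0
    convert (hspec w hw).2.comp e using 1
    ext1 v
    by_cases h : v.1 < w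
    · simp [e, h]
    · have : v.1 = w := le_antisymm v.2 (not_lt.1 h)
      simp [e, this]
  -- A finite set of indices lies below its largest element, so that limit stages are harmless.
  have hfin : ∀ s : Set W, (∀ w ∈ s, AlmostElementary L u (fun v : Iic w => F v.1)) →
      AlmostElementary L u (fun v : s => F v.1) := by
    intro s hs
    refine AlmostElementary.of_finset fun T₀ => ?_
    rcases T₀.eq_empty_or_nonempty with rfl | hT
    · exact almostElementary_of_isEmpty _
    · obtain ⟨w, -, hwmax⟩ := T₀.exists_max_image id hT
      exact (hs w.1 w.2).comp (fun v : T₀ => (⟨v.1.1, hwmax v.1 v.2⟩ : Iic w.1))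
  have hIio : ∀ w, AlmostElementary L u (fun v : Iio w => F v.1) := by
    intro w
    induction w using WellFoundedLT.induction with
    | ind w ih => exact hfin _ fun v hv => hIic v (ih v hv)
  refine ⟨F, ?_, fun w => (hspec w (hIio w)).1⟩
  exact (hfin univ fun w _ => hIic w (hIio w)).comp (fun w => (⟨w, mem_univ w⟩ : (univ : Set W)))

/-- The transfinite back-and-forth: if there are at most `ℵ₁` sequences in `A`, then there is an
almost elementary family of pairs in which every sequence and every double sequence occurs. -/
theorem exists_almostElementary [Countable L.Symbols]
    (hA : Cardinal.mk ((ℕ → A) ⊕ (ℕ → ℕ → A)) ≤ Cardinal.aleph 1) :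
    ∃ F : (ℕ → A) ⊕ (ℕ → ℕ → A) → (ℕ → A) × (ℕ → ℕ → A),
      AlmostElementary L u F ∧ (∀ f, (F (Sum.inl f)).1 = f) ∧ ∀ g, (F (Sum.inr g)).2 = g := by
  obtain ⟨W, ⟨e⟩⟩ : ∃ W : Type, Nonempty (W ≃ ((ℕ → A) ⊕ (ℕ → ℕ → A))) := ⟨_, ⟨Equiv.refl _⟩⟩
  obtain ⟨_, _, hord⟩ := Cardinal.exists_ord_eq_type_lt W
  have hW : ∀ w : W, (Iio w).Countable := by
    intro w
    have h1 := (Cardinal.mk_Iio_lt w hord).trans_le ((Cardinal.mk_congr e).trans_le hA)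
    rwa [← Cardinal.succ_aleph0, Order.lt_succ_iff, Cardinal.le_aleph0_iff_set_countable] at h1
  obtain ⟨F, hF, hmeets⟩ := exists_almostElementary_of_wellOrder (L := L) (u := u) hW e
  refine ⟨F ∘ e.symm, hF.comp e.symm, fun f => ?_, fun g => ?_⟩
  · ext1 k
    simpa [Meets] using hmeets (e.symm (Sum.inl f)) k
  · ext1 k
    simpa [Meets] using hmeets (e.symm (Sum.inr g)) k

end BackAndForth

/-! ### Maps of the unit interval and rational patterns of values -/

/-- The relational language whose `n`-ary symbols consist of one of three subsets of `I` and of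
`n` intervals with rational endpoints. -/
def cellLanguage : FirstOrder.Language.{0, 0} :=
  ⟨fun _ => Empty, fun n => Fin 3 × (Fin n → ℚ × ℚ)⟩

/-- The three subsets of the unit interval that the relation symbols refer to: the left end point,
the right end point, and the whole interval. -/
def cellPart : Fin 3 → Set I := ![{0}, {1}, univ]

/-- A symbol holds for `f₁, …, fₙ` if some point of the given part of `I` is mapped by every `fᵢ`
into the `i`-th of the given rational intervals. -/
instance : cellLanguage.Structure C(I, I) where
  funMap f := f.elim
  RelMap {_} r f := ∃ x ∈ cellPart r.1, ∀ i, ((r.2 i).1 : ℝ) < f i x ∧ (f i x : ℝ) < (r.2 i).2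

instance : Countable cellLanguage.Symbols := by
  have h1 : Countable (Σ l, cellLanguage.Functions l) :=
    inferInstanceAs (Countable (Σ _ : ℕ, Empty))
  have h2 : Countable (Σ l, cellLanguage.Relations l) :=
    inferInstanceAs (Countable (Σ n : ℕ, Fin 3 × (Fin n → ℚ × ℚ)))
  exact inferInstanceAs (Countable ((Σ l, cellLanguage.Functions l) ⊕
    (Σ l, cellLanguage.Relations l)))

/-- A continuous map is determined by its values on a countable dense set. -/
theorem mk_continuousMap_le : Cardinal.mk C(I, I) ≤ Cardinal.continuum := by
  have hinj : Function.Injective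
      (fun (f : C(I, I)) (n : ℕ) => f (TopologicalSpace.denseSeq I n)) := by
    intro f g hfg
    refine DFunLike.coe_injective (Continuous.ext_on (TopologicalSpace.denseRange_denseSeq I)
      f.continuous g.continuous ?_)
    rintro _ ⟨n, rfl⟩
    exact congrFun hfg n
  have hI : Cardinal.mk I ≤ Cardinal.continuum := (Cardinal.mk_set_le _).trans_eq Cardinal.mk_real
  calc Cardinal.mk C(I, I) ≤ Cardinal.mk (ℕ → I) := Cardinal.mk_le_of_injective hinj
    _ = Cardinal.mk I ^ Cardinal.aleph0 := by simp
    _ ≤ Cardinal.continuum ^ Cardinal.aleph0 := Cardinal.power_le_power_right hI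
    _ = Cardinal.continuum := Cardinal.continuum_power_aleph0

theorem mk_sequences_le :
    Cardinal.mk ((ℕ → C(I, I)) ⊕ (ℕ → ℕ → C(I, I))) ≤ Cardinal.continuum := by
  have h1 : Cardinal.mk (ℕ → C(I, I)) ≤ Cardinal.continuum := by
    calc Cardinal.mk (ℕ → C(I, I)) = Cardinal.mk C(I, I) ^ Cardinal.aleph0 := by simp
      _ ≤ Cardinal.continuum ^ Cardinal.aleph0 := Cardinal.power_le_power_right mk_continuousMap_le
      _ = Cardinal.continuum := Cardinal.continuum_power_aleph0
  have h2 : Cardinal.mk (ℕ → ℕ → C(I, I)) ≤ Cardinal.continuum := by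
    calc Cardinal.mk (ℕ → ℕ → C(I, I)) = Cardinal.mk (ℕ → C(I, I)) ^ Cardinal.aleph0 := by
          simp
      _ ≤ Cardinal.continuum ^ Cardinal.aleph0 := Cardinal.power_le_power_right h1
      _ = Cardinal.continuum := Cardinal.continuum_power_aleph0
  rw [Cardinal.mk_sum, Cardinal.lift_id, Cardinal.lift_id]
  exact (add_le_add h1 h2).trans_eq Cardinal.continuum_add_self

/-- A family of pairs of a sequence `f` and a double sequence `g` of maps is a matching along `u`
if every finite pattern of values is attained in the same way on both sides: for all but finitely
many `k`, finitely many `f k` simultaneously take values in given rational intervals at some point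
of a given part of `I` if and only if the corresponding `g k m` do so for `u`-almost all `m`. -/
def IsMatching (u : Ultrafilter ℕ) {W : Type}
    (F : W → (ℕ → C(I, I)) × (ℕ → ℕ → C(I, I))) : Prop :=
  ∀ (n : ℕ) (t : Fin n → W) (J : Fin 3) (c : Fin n → ℚ × ℚ), ∀ᶠ k in atTop,
    ((∃ x ∈ cellPart J, ∀ i, ((c i).1 : ℝ) < (F (t i)).1 k x ∧
        ((F (t i)).1 k x : ℝ) < (c i).2) ↔
      ∀ᶠ m in (u : Filter ℕ), ∃ x ∈ cellPart J, ∀ i, ((c i).1 : ℝ) < (F (t i)).2 k m x ∧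
        ((F (t i)).2 k m x : ℝ) < (c i).2)

theorem exists_isMatching (hCH : Cardinal.aleph 1 = (Cardinal.continuum : Cardinal.{0}))
    (u : Ultrafilter ℕ) :
    ∃ (W : Type) (F : W → (ℕ → C(I, I)) × (ℕ → ℕ → C(I, I))), IsMatching u F ∧
      (∀ f, ∃ w, (F w).1 = f) ∧ ∀ g, ∃ w, (F w).2 = g := by
  obtain ⟨F, hF, h1, h2⟩ := exists_almostElementary (L := cellLanguage) (u := u)
    (mk_sequences_le.trans_eq hCH.symm)
  refine ⟨_, F, fun n t J c => ?_, fun f => ⟨_, h1 f⟩, fun g => ⟨_, h2 g⟩⟩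
  refine (hF.comp t) {v | ∃ x ∈ cellPart J, ∀ i, ((c i).1 : ℝ) < v i x ∧ (v i x : ℝ) < (c i).2} ?_
  let r : cellLanguage.Relations n := (J, c)
  exact Set.empty_definable_iff.2 ⟨r.formula fun i => FirstOrder.Language.Term.var i, rfl⟩

/-- The unit interval is covered by finitely many short intervals with rational end points. -/
theorem exists_rat_cover {ε : ℝ} (hε : 0 < ε) : ∃ s : Finset (ℚ × ℚ),
    (∀ c ∈ s, ((c.2 : ℝ) - c.1) < ε) ∧ ∀ x : I, ∃ c ∈ s, (c.1 : ℝ) < x ∧ (x : ℝ) < c.2 := by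
  have hloc : ∀ x : I, ∃ c : ℚ × ℚ, ((c.2 : ℝ) - c.1) < ε ∧ (c.1 : ℝ) < x ∧ (x : ℝ) < c.2 := by
    intro x
    obtain ⟨a, ha, ha'⟩ := exists_rat_btwn (show (x : ℝ) - ε / 2 < x by linarith)
    obtain ⟨b, hb, hb'⟩ := exists_rat_btwn (show (x : ℝ) < x + ε / 2 by linarith)
    exact ⟨(a, b), by simp only; linarith, ha', hb⟩
  choose c hc hc' using hloc
  obtain ⟨s, hs⟩ := isCompact_univ.elim_finite_subcover
    (fun y : I => {x : I | ((c y).1 : ℝ) < x ∧ (x : ℝ) < (c y).2})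
    (fun y => (isOpen_lt continuous_const continuous_subtype_val).inter
      (isOpen_lt continuous_subtype_val continuous_const))
    (fun x _ => mem_iUnion.2 ⟨x, hc' x⟩)
  classical
  refine ⟨s.image c, by simp only [Finset.mem_image]; rintro _ ⟨y, -, rfl⟩; exact hc y, fun x => ?_⟩
  obtain ⟨y, hy, hxy⟩ := mem_iUnion₂.1 (hs (mem_univ x))
  exact ⟨c y, Finset.mem_image_of_mem c hy, hxy⟩

/-- A matching approximately preserves the values at the end points of `I`: finitely many short
rational intervals cover all possible values, and each of them is eventually matched. -/
theorem IsMatching.eventually_dist_endpoint {u : Ultrafilter ℕ} {W : Type}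
    {F : W → (ℕ → C(I, I)) × (ℕ → ℕ → C(I, I))} (hF : IsMatching u F) (w : W) (J : Fin 3) (e : I)
    (he : cellPart J = {e}) {ε : ℝ} (hε : 0 < ε) :
    ∀ᶠ k in atTop, ∀ᶠ m in (u : Filter ℕ), dist ((F w).1 k e) ((F w).2 k m e) < ε := by
  obtain ⟨s, hs, hcov⟩ := exists_rat_cover hε
  have h := (s.finite_toSet.eventually_all (l := atTop)).2
    (fun c _ => hF 1 (fun _ => w) J (fun _ => c))
  filter_upwards [h] with k hk
  obtain ⟨c, hc, hxc⟩ := hcov ((F w).1 k e)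
  have := (hk c hc).1 (by rw [he]; exact ⟨e, rfl, fun _ => hxc⟩)
  filter_upwards [this] with m hm
  rw [he] at hm
  obtain ⟨x, rfl, hx⟩ := hm
  have := hs c hc
  have hx := hx 0
  rw [Subtype.dist_eq, Real.dist_eq, abs_lt]
  constructor <;> linarith [hx.1, hx.2, hxc.1, hxc.2]

/-! ### The order of the standard subcontinuum and the supremum layer -/

section Trace

variable {X : Type*} [TopologicalSpace X]

/-- The filter on `X` of the traces of the neighbourhoods of a point of `βX`. -/
def trace (p : StoneCech X) : Filter X := comap stoneCechUnit (𝓝 p)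

instance (p : StoneCech X) : (trace p).NeBot :=
  comap_neBot_iff_frequently.2
    (mem_closure_iff_frequently.1 (denseRange_stoneCechUnit p))

theorem tendsto_trace (p : StoneCech X) : Tendsto stoneCechUnit (trace p) (𝓝 p) := tendsto_comap

theorem mem_closure_image_iff {p : StoneCech X} {S : Set X} :
    p ∈ closure (stoneCechUnit '' S) ↔ ∃ᶠ x in trace p, x ∈ S := by
  rw [mem_closure_iff_frequently, trace, frequently_comap]
  simp only [mem_image, and_comm]

/-- In a normal space, disjoint closed sets have disjoint closures in `βX`. -/
theorem not_mem_closure_of_disjoint [NormalSpace X] {p : StoneCech X} {S T : Set X}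
    (hS : IsClosed S) (hT : IsClosed T) (hST : Disjoint S T)
    (h1 : ∃ᶠ x in trace p, x ∈ S) (h2 : ∃ᶠ x in trace p, x ∈ T) : False := by
  obtain ⟨f, hf0, hf1, hf⟩ := exists_continuous_zero_one_of_isClosed hS hT hST
  let g : X → I := fun x => ⟨f x, hf x⟩
  have hg : Continuous g := f.continuous.subtype_mk _
  have hlim : Tendsto g (trace p) (𝓝 (stoneCechExtend hg p)) := by
    have := ((continuous_stoneCechExtend hg).tendsto p).comp (tendsto_trace p)
    rwa [stoneCechExtend_extends] at this
  have e0 : stoneCechExtend hg p = 0 := by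
    by_contra hne
    obtain ⟨x, hx, hxS⟩ := (h1.and_eventually (hlim.eventually_ne hne)).exists
    exact hxS (Subtype.ext (hf0 hx))
  have e1 : stoneCechExtend hg p = 1 := by
    by_contra hne
    obtain ⟨x, hx, hxS⟩ := (h2.and_eventually (hlim.eventually_ne hne)).exists
    exact hxS (Subtype.ext (hf1 hx))
  exact zero_ne_one (e0.symm.trans e1)

end Trace

section Fiber

variable {u : Ultrafilter ℕ}

theorem continuous_betaProj : Continuous betaProj := continuous_stoneCechExtend _

theorem betaProj_stoneCechUnit (x : Mspace) : betaProj (stoneCechUnit x) = pure x.1 :=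
  stoneCechExtend_stoneCechUnit (g := fun p : Mspace => (pure p.1 : Ultrafilter ℕ))
    (continuous_of_discreteTopology.comp continuous_fst) x

theorem eventually_trace_fst {p : StoneCech Mspace} (hp : p ∈ fiber u) {P : ℕ → Prop}
    (hP : ∀ᶠ n in (u : Filter ℕ), P n) : ∀ᶠ x in trace p, P x.1 := by
  have hopen := ultrafilter_isOpen_basic {n | P n}
  have hmem : betaProj p ∈ {v : Ultrafilter ℕ | {n | P n} ∈ v} := by
    rw [show betaProj p = u from hp]; exact hP
  have hlim := (tendsto_trace p).eventually
    (continuous_betaProj.continuousAt.eventually (hopen.mem_nhds hmem))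
  filter_upwards [hlim] with x hx
  rw [betaProj_stoneCechUnit] at hx
  exact hx

theorem isClosed_fiber : IsClosed (fiber u) :=
  isClosed_singleton.preimage continuous_betaProj

/-- The `u`-limit of the points `(n, t n)`. -/
def standardPoint (u : Ultrafilter ℕ) (t : ℕ → I) : StoneCech Mspace :=
  Ultrafilter.extend (fun n : ℕ => stoneCechUnit ((n, t n) : Mspace)) u

theorem tendsto_standardPoint (t : ℕ → I) :
    Tendsto (fun n : ℕ => stoneCechUnit ((n, t n) : Mspace)) u (𝓝 (standardPoint u t)) :=
  ultrafilter_extend_eq_iff.1 rfl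

theorem standardPoint_mem_fiber (t : ℕ → I) : standardPoint u t ∈ fiber u := by
  have h1 := (continuous_betaProj.tendsto _).comp (tendsto_standardPoint (u := u) t)
  refine tendsto_nhds_unique h1 ?_
  convert Ultrafilter.tendsto_pure_self u using 1
  ext1 n
  exact betaProj_stoneCechUnit _

theorem standardPoint_mem_of_isClosed {t : ℕ → I} {C : Set (StoneCech Mspace)} (hC : IsClosed C)
    (h : ∀ᶠ n in (u : Filter ℕ), stoneCechUnit ((n, t n) : Mspace) ∈ C) :
    standardPoint u t ∈ C :=
  hC.mem_of_tendsto (tendsto_standardPoint t) h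

/-- The closure in `β𝕄` of the points on or below the graph of `z`; its intersection with the
fiber of `u` is the interval from `0_u` to the `u`-limit of the points `(n, z n)`. -/
def lower (z : ℕ → I) : Set (StoneCech Mspace) :=
  closure (stoneCechUnit '' {x : Mspace | x.2 ≤ z x.1})

/-- The closure in `β𝕄` of the points on or above the graph of `z`. -/
def upper (z : ℕ → I) : Set (StoneCech Mspace) :=
  closure (stoneCechUnit '' {x : Mspace | z x.1 ≤ x.2})

theorem mem_lower_iff {p : StoneCech Mspace} {z : ℕ → I} :
    p ∈ lower z ↔ ∃ᶠ x in trace p, x.2 ≤ z x.1 := mem_closure_image_iff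

theorem mem_upper_iff {p : StoneCech Mspace} {z : ℕ → I} :
    p ∈ upper z ↔ ∃ᶠ x in trace p, z x.1 ≤ x.2 := mem_closure_image_iff

theorem mem_lower_or_mem_upper (p : StoneCech Mspace) (z : ℕ → I) : p ∈ lower z ∨ p ∈ upper z := by
  rw [mem_lower_iff, mem_upper_iff, ← frequently_or_distrib]
  exact (Eventually.of_forall fun x => le_total _ _).frequently

theorem lower_mono {p : StoneCech Mspace} (hp : p ∈ fiber u) {z z' : ℕ → I}
    (h : ∀ᶠ n in (u : Filter ℕ), z n ≤ z' n) (hz : p ∈ lower z) : p ∈ lower z' := by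
  rw [mem_lower_iff] at hz ⊢
  exact (hz.and_eventually (eventually_trace_fst hp h)).mono fun x hx => hx.1.trans hx.2

theorem continuous_comp_fst (z : ℕ → I) : Continuous fun x : Mspace => z x.1 :=
  continuous_of_discreteTopology.comp continuous_fst

theorem not_mem_upper_of_mem_lower {p : StoneCech Mspace} (hp : p ∈ fiber u) {z z' : ℕ → I}
    (h : ∀ᶠ n in (u : Filter ℕ), z n < z' n) (hz : p ∈ lower z) : p ∉ upper z' := by
  intro hz'
  rw [mem_lower_iff] at hz
  rw [mem_upper_iff] at hz'
  have hU : IsClosed {x : Mspace | z x.1 < z' x.1} :=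
    (isClosed_discrete {n | z n < z' n}).preimage continuous_fst
  refine not_mem_closure_of_disjoint (p := p)
    (S := {x | x.2 ≤ z x.1} ∩ {x : Mspace | z x.1 < z' x.1})
    (T := {x | z' x.1 ≤ x.2})
    ((isClosed_le continuous_snd (continuous_comp_fst z)).inter hU)
    (isClosed_le (continuous_comp_fst z') continuous_snd) ?_ ?_ hz'
  · rw [Set.disjoint_left]
    rintro x ⟨hx1, hx2⟩ hx3
    have hx4 : z' x.1 ≤ z x.1 := le_trans (show z' x.1 ≤ x.2 from hx3) hx1
    exact absurd hx2 (not_lt.2 hx4)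
  · exact hz.and_eventually (eventually_trace_fst hp h)

theorem bottom_mem_fiber : bottom u ∈ fiber u := standardPoint_mem_fiber fun _ => 0

theorem bottom_mem_lower (z : ℕ → I) : bottom u ∈ lower z :=
  standardPoint_mem_of_isClosed (t := fun _ => 0) isClosed_closure
    (Eventually.of_forall fun _ => subset_closure ⟨_, nonneg', rfl⟩)

/-- A continuous function that is below `1 / 2` at `0_u` and above it at a point of `lower z` takes
the value `1 / 2` on that interval: the intermediate value theorem in every fiber `{n} × I`. -/
theorem exists_mem_lower_eq_half {φ : C(StoneCech Mspace, ℝ)} {z : ℕ → I} {p : StoneCech Mspace}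
    (hp : p ∈ fiber u) (hz : p ∈ lower z) (h0 : φ (bottom u) < 1 / 2) (h1 : 1 / 2 < φ p) :
    ∃ q ∈ lower z ∩ fiber u, φ q = 1 / 2 := by
  have hbot : ∀ᶠ n in (u : Filter ℕ), φ (stoneCechUnit ((n, 0) : Mspace)) < 1 / 2 :=
    ((φ.continuous.tendsto _).comp (tendsto_standardPoint (u := u) fun _ => 0)).eventually_lt_const
      h0
  have htop : ∀ᶠ n in (u : Filter ℕ), ∃ t ≤ z n, 1 / 2 < φ (stoneCechUnit ((n, t) : Mspace)) := by
    by_contra hcon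
    rw [← Ultrafilter.eventually_not] at hcon
    have hφ := ((φ.continuous.tendsto _).comp (tendsto_trace p)).eventually_const_lt h1
    obtain ⟨x, hx, hx', hx''⟩ := ((mem_lower_iff.1 hz).and_eventually
      ((eventually_trace_fst hp hcon).and hφ)).exists
    exact hx' ⟨x.2, hx, hx''⟩
  have hex : ∀ᶠ n in (u : Filter ℕ), ∃ t ≤ z n, φ (stoneCechUnit ((n, t) : Mspace)) = 1 / 2 := by
    filter_upwards [hbot, htop] with n hn ⟨t, htz, ht⟩
    have hc : Continuous fun s : I => φ (stoneCechUnit ((n, s) : Mspace)) :=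
      φ.continuous.comp (continuous_stoneCechUnit.comp (by fun_prop))
    obtain ⟨s, hs, hs'⟩ := intermediate_value_Icc (a := (0 : I)) (b := t) nonneg'
      hc.continuousOn ⟨hn.le, ht.le⟩
    exact ⟨s, hs.2.trans htz, hs'⟩
  let t : ℕ → I := fun n => Classical.epsilon fun t =>
    t ≤ z n ∧ φ (stoneCechUnit ((n, t) : Mspace)) = 1 / 2
  have ht : ∀ᶠ n in (u : Filter ℕ), t n ≤ z n ∧ φ (stoneCechUnit ((n, t n) : Mspace)) = 1 / 2 :=
    hex.mono fun n hn => Classical.epsilon_spec hn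
  refine ⟨standardPoint u t, ⟨standardPoint_mem_of_isClosed isClosed_closure ?_,
    standardPoint_mem_fiber t⟩,
    standardPoint_mem_of_isClosed (isClosed_singleton.preimage φ.continuous) ?_⟩
  · exact ht.mono fun n hn => subset_closure ⟨_, hn.1, rfl⟩
  · exact ht.mono fun n hn => hn.2

/-- The standard intervals are connected; this is the intermediate value property above. -/
theorem isSubcontinuum_lower (z : ℕ → I) : IsSubcontinuum u (lower z ∩ fiber u) := by
  have hcl : IsClosed (lower z ∩ fiber u) := isClosed_closure.inter isClosed_fiber
  refine ⟨inter_subset_right, hcl, ⟨_, bottom_mem_lower z, bottom_mem_fiber⟩, ?_⟩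
  have key : ∀ v w : Set (StoneCech Mspace), IsClosed v → IsClosed w →
      lower z ∩ fiber u ⊆ v ∪ w → Disjoint v w → bottom u ∈ v → lower z ∩ fiber u ⊆ v := by
    intro v w hv hw hvw hdisj hb p hp
    refine (hvw hp).resolve_right fun hpw => ?_
    obtain ⟨φ, h0, h1, -⟩ := exists_continuous_zero_one_of_isClosed hv hw hdisj
    obtain ⟨q, hq, hq'⟩ := exists_mem_lower_eq_half (φ := φ) hp.2 hp.1
      (by rw [h0 hb]; norm_num) (by rw [h1 hpw]; norm_num)
    rcases hvw hq with h | h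
    · rw [h0 h] at hq'; norm_num at hq'
    · rw [h1 h] at hq'; norm_num at hq'
  rw [isPreconnected_iff_subset_of_fully_disjoint_closed hcl]
  intro v w hv hw hvw hdisj
  rcases hvw ⟨bottom_mem_lower z, bottom_mem_fiber⟩ with h | h
  · exact Or.inl (key v w hv hw hvw hdisj h)
  · exact Or.inr (key w v hw hv (by rwa [union_comm]) hdisj.symm h)

/-- Subcontinua that contain `0_u` are intersections of standard intervals: a point outside such a
subcontinuum is separated from it by the first place where a Urysohn function reaches `1 / 2`. -/
theorem exists_subset_lower {K : Set (StoneCech Mspace)} (hK : IsSubcontinuum u K)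
    (hb : bottom u ∈ K) {p : StoneCech Mspace} (hp : p ∈ fiber u) (hpK : p ∉ K) :
    ∃ z : ℕ → I, K ⊆ lower z ∧ p ∉ lower z := by
  obtain ⟨φ, h0, h1, -⟩ := exists_continuous_zero_one_of_isClosed hK.2.1 isClosed_singleton
    (disjoint_singleton_right.2 hpK)
  have hφp : φ p = 1 := h1 rfl
  let f : Mspace → ℝ := fun x => φ (stoneCechUnit x)
  have hf : Continuous f := φ.continuous.comp continuous_stoneCechUnit
  let R : ℕ → Set I := fun n => {t | 1 / 2 ≤ f (n, t)}
  have hR : ∀ n, IsClosed (R n) := fun n =>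
    isClosed_le continuous_const (hf.comp (by fun_prop))
  let z : ℕ → I := fun n => sInf (R n)
  have hz : ∀ n t, t ∈ R n → z n ≤ t := fun n t ht => sInf_le ht
  have hbot : ∀ᶠ n in (u : Filter ℕ), f (n, 0) < 1 / 4 :=
    ((φ.continuous.tendsto _).comp (tendsto_standardPoint (u := u) fun _ => 0)).eventually_lt_const
      (show φ (bottom u) < 1 / 4 by rw [h0 hb]; norm_num)
  refine ⟨z, ?_, fun hpz => ?_⟩
  · -- The set where `f ≤ 1 / 4` splits into the parts below and above the graph of `z`. If `R n` is
    -- empty, then `z n = sInf ∅ = 1` and the whole fiber belongs to the lower part.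
    let S₁ : Set Mspace := {x | x.2 ≤ z x.1} ∩ {x | f x ≤ 1 / 4}
    let S₂ : Set Mspace := ({x | z x.1 ≤ x.2} ∩ {x | f x ≤ 1 / 4}) ∩ {x | (R x.1).Nonempty}
    have hS₁ : IsClosed S₁ := (isClosed_le continuous_snd (continuous_comp_fst z)).inter
      (isClosed_le hf continuous_const)
    have hS₂ : IsClosed S₂ := ((isClosed_le (continuous_comp_fst z) continuous_snd).inter
      (isClosed_le hf continuous_const)).inter
        ((isClosed_discrete {n | (R n).Nonempty}).preimage continuous_fst)
    have hdisj : Disjoint S₁ S₂ := by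
      rw [Set.disjoint_left]
      rintro ⟨n, t⟩ ⟨ht, hft⟩ ⟨⟨ht', -⟩, hne⟩
      have hmem : z n ∈ R n := (hR n).csInf_mem hne (OrderBot.bddBelow _)
      have : t = z n := le_antisymm ht ht'
      rw [← this] at hmem
      have h2 : (1 : ℝ) / 2 ≤ f (n, t) := hmem
      have h3 : f (n, t) ≤ 1 / 4 := hft
      linarith
    have hcov : K ⊆ closure (stoneCechUnit '' S₁) ∪ closure (stoneCechUnit '' S₂) := by
      intro q hq
      have hφq := ((φ.continuous.tendsto _).comp (tendsto_trace q)).eventually_lt_const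
        (show φ q < 1 / 4 by rw [h0 hq]; norm_num)
      rw [mem_union, mem_closure_image_iff, mem_closure_image_iff, ← frequently_or_distrib]
      refine (hφq.mono fun x hx => ?_).frequently
      rcases le_or_gt x.2 (z x.1) with h | h
      · exact Or.inl ⟨h, le_of_lt hx⟩
      · refine Or.inr ⟨⟨h.le, le_of_lt hx⟩, ?_⟩
        by_contra hne
        rw [mem_ofPred_eq, not_nonempty_iff_eq_empty] at hne
        have : z x.1 = ⊤ := by simp only [z, hne, sInf_empty]
        exact absurd h (by rw [this]; exact not_top_lt)
    rcases isPreconnected_iff_subset_of_disjoint_closed.1 hK.2.2.isPreconnected _ _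
      isClosed_closure isClosed_closure hcov (by
        rw [← Set.disjoint_iff_inter_eq_empty, Set.disjoint_left]
        rintro q - ⟨hq1, hq2⟩
        exact not_mem_closure_of_disjoint hS₁ hS₂ hdisj (mem_closure_image_iff.1 hq1)
          (mem_closure_image_iff.1 hq2)) with h | h
    · exact h.trans (closure_mono (image_mono inter_subset_left))
    · have hb1 : bottom u ∈ closure (stoneCechUnit '' S₁) :=
        standardPoint_mem_of_isClosed (t := fun _ => 0) isClosed_closure
          (hbot.mono fun n hn => subset_closure ⟨_, ⟨nonneg', le_of_lt hn⟩, rfl⟩)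
      exact (not_mem_closure_of_disjoint hS₁ hS₂ hdisj (mem_closure_image_iff.1 hb1)
          (mem_closure_image_iff.1 (h hb))).elim
  · have hφp' := ((φ.continuous.tendsto _).comp (tendsto_trace p)).eventually_const_lt
      (show 3 / 4 < φ p by rw [hφp]; norm_num)
    obtain ⟨⟨n, t⟩, ht, hn, hft⟩ := ((mem_lower_iff.1 hpz).and_eventually
      ((eventually_trace_fst hp hbot).and hφp')).exists
    have hft' : 3 / 4 < f (n, t) := hft
    have hc : Continuous fun s : I => f (n, s) := hf.comp (by fun_prop)
    obtain ⟨s, hs, hs'⟩ := intermediate_value_Icc (a := (0 : I)) (b := t) nonneg'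
      hc.continuousOn (show (1 / 2 : ℝ) ∈ _ from ⟨by simp only at hn; linarith, by linarith⟩)
    have hs'' : f (n, s) = 1 / 2 := hs'
    have hst : s = t := le_antisymm hs.2 (ht.trans (hz n s hs''.ge))
    rw [hst] at hs''
    linarith

/-- The preorder is determined by the standard intervals. -/
theorem le_iff {p q : StoneCech Mspace} (hp : p ∈ fiber u) (hq : q ∈ fiber u) :
    le u p q ↔ ∀ z, q ∈ lower z → p ∈ lower z := by
  constructor
  · intro h z hz
    exact (h _ (isSubcontinuum_lower z) ⟨bottom_mem_lower z, bottom_mem_fiber⟩ ⟨hz, hq⟩).1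
  · intro h K hK hb hqK
    by_contra hpK
    obtain ⟨z, hKz, hpz⟩ := exists_subset_lower hK hb hp hpK
    exact hpz (h z (hKz hqK))

theorem exists_lower_of_lt {p q : StoneCech Mspace} (hp : p ∈ fiber u) (hq : q ∈ fiber u)
    (h : lt u p q) : ∃ z, p ∈ lower z ∧ q ∉ lower z := by
  have := h.2
  rw [le_iff hq hp] at this
  push Not at this
  exact this

end Fiber

section SupremumLayer

variable {u : Ultrafilter ℕ}

/-- The points that lie above all of the standard points given by `z 0, z 1, …` and below every
standard point that is above all of these. -/
def limitLayer (u : Ultrafilter ℕ) (z : ℕ → ℕ → I) : Set (StoneCech Mspace) :=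
  {y | y ∈ fiber u ∧ (∀ k, y ∈ upper (z k)) ∧
    ∀ t : ℕ → I, (∀ k, ∀ᶠ n in (u : Filter ℕ), z k n ≤ t n) → y ∈ lower t}

theorem isClosed_limitLayer (z : ℕ → ℕ → I) : IsClosed (limitLayer u z) := by
  have : limitLayer u z = fiber u ∩ (⋂ k, upper (z k)) ∩
      ⋂ (t : ℕ → I) (_ : ∀ k, ∀ᶠ n in (u : Filter ℕ), z k n ≤ t n), lower t := by
    ext y
    simp only [limitLayer, mem_inter_iff, mem_iInter, and_assoc]
    rfl
  rw [this]
  exact (isClosed_fiber.inter (isClosed_iInter fun k => isClosed_closure)).inter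
    (isClosed_iInter fun t => isClosed_iInter fun _ => isClosed_closure)

/-- The supremum layer of a strictly increasing sequence is determined by standard points that
interleave with the sequence. -/
theorem exists_isSupremumLayer_iff {a : ℕ → StoneCech Mspace} (ha : ∀ n, a n ∈ fiber u)
    (hmono : ∀ m n, m < n → lt u (a m) (a n)) :
    ∃ z : ℕ → ℕ → I, (∀ k, ∀ᶠ n in (u : Filter ℕ), z k n < z (k + 1) n) ∧
      ∀ L, IsSupremumLayer u a L ↔ L = limitLayer u z ∧ (limitLayer u z).Nonempty := by
  have hex : ∀ k, ∃ z, a k ∈ lower z ∧ a (k + 1) ∉ lower z := fun k =>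
    exists_lower_of_lt (ha k) (ha (k + 1)) (hmono k (k + 1) k.lt_succ_self)
  choose z hz hz' using hex
  have hlt : ∀ k, ∀ᶠ n in (u : Filter ℕ), z k n < z (k + 1) n := by
    intro k
    by_contra hcon
    rw [← Ultrafilter.eventually_not] at hcon
    exact hz' k (lower_mono (ha _) (hcon.mono fun n hn => not_lt.1 hn) (hz (k + 1)))
  have hub : ∀ y ∈ fiber u, (∀ n, le u (a n) y) ↔ ∀ k, y ∈ upper (z k) := by
    intro y hy
    constructor
    · intro h k
      refine (mem_lower_or_mem_upper y (z k)).resolve_left fun hyk => hz' k ?_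
      exact (le_iff (ha _) hy).1 (h (k + 1)) _ hyk
    · intro h k
      rw [le_iff (ha _) hy]
      intro t ht
      refine lower_mono (ha k) (z := z k) ?_ (hz k)
      by_contra hcon
      rw [← Ultrafilter.eventually_not] at hcon
      exact not_mem_upper_of_mem_lower hy (hcon.mono fun n hn => not_le.1 hn) ht (h k)
  have hlub : ∀ y ∈ fiber u, ((∀ n, le u (a n) y) ∧
      (∀ q ∈ fiber u, (∀ n, le u (a n) q) → le u y q)) ↔ y ∈ limitLayer u z := by
    intro y hy
    constructor
    · rintro ⟨h1, h2⟩
      refine ⟨hy, (hub y hy).1 h1, fun t ht => ?_⟩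
      have hq := standardPoint_mem_fiber (u := u) t
      have := h2 _ hq ((hub _ hq).2 fun k => standardPoint_mem_of_isClosed isClosed_closure
        ((ht k).mono fun n hn => subset_closure ⟨_, hn, rfl⟩))
      exact (le_iff hy hq).1 this t (standardPoint_mem_of_isClosed isClosed_closure
        (Eventually.of_forall fun n => subset_closure ⟨_, le_refl (t n), rfl⟩))
    · rintro ⟨-, h1, h2⟩
      refine ⟨(hub y hy).2 h1, fun q hq hqu => (le_iff hy hq).2 fun t ht => h2 t fun k => ?_⟩
      by_contra hcon
      rw [← Ultrafilter.eventually_not] at hcon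
      exact not_mem_upper_of_mem_lower hq (hcon.mono fun n hn => not_le.1 hn) ht
        ((hub q hq).1 hqu k)
  have hlayer : ∀ x ∈ limitLayer u z, layer u x = limitLayer u z := by
    intro x hx
    obtain ⟨hx1, hx2⟩ := (hlub x hx.1).2 hx
    ext y
    constructor
    · rintro ⟨hy, hyx, hxy⟩
      exact (hlub y hy).1 ⟨fun n K hK hb hyK => hx1 n K hK hb (hxy K hK hb hyK),
        fun q hq hqu K hK hb hqK => hyx K hK hb (hx2 q hq hqu K hK hb hqK)⟩
    · intro hy
      obtain ⟨hy1, hy2⟩ := (hlub y hy.1).2 hy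
      exact ⟨hy.1, hy2 x hx.1 hx1, hx2 y hy.1 hy1⟩
  refine ⟨z, hlt, fun L => ⟨?_, ?_⟩⟩
  · rintro ⟨x, hx, h1, h2, rfl⟩
    have hx' := (hlub x hx).1 ⟨h1, h2⟩
    exact ⟨hlayer x hx', x, hx'⟩
  · rintro ⟨rfl, x, hx⟩
    obtain ⟨h1, h2⟩ := (hlub x hx.1).2 hx
    exact ⟨x, hx.1, h1, h2, (hlayer x hx).symm⟩

end SupremumLayer

/-! ### Segments between standard points, and the half line -/

section Cells

/-- The point that divides the segment from `z k m` to `z (k + 1) m` in the ratio `s : 1 - s`. -/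
def cellPoint (z : ℕ → ℕ → I) (k m : ℕ) (s : I) : I :=
  ⟨(1 - (s : ℝ)) * z k m + s * z (k + 1) m, by
    have h1 := (z k m).2.1
    have h2 := (z k m).2.2
    have h3 := (z (k + 1) m).2.1
    have h4 := (z (k + 1) m).2.2
    have h5 := s.2.1
    have h6 := s.2.2
    constructor
    · have := mul_nonneg (sub_nonneg.2 h6) h1
      have := mul_nonneg h5 h3
      linarith
    · have := mul_le_mul_of_nonneg_left h2 (sub_nonneg.2 h6)
      have := mul_le_mul_of_nonneg_left h4 h5
      linarith⟩

variable {z : ℕ → ℕ → I} {k m : ℕ}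

theorem coe_cellPoint (s : I) :
    (cellPoint z k m s : ℝ) = (1 - (s : ℝ)) * z k m + s * z (k + 1) m := rfl

theorem continuous_cellPoint : Continuous (cellPoint z k m) := by
  unfold cellPoint
  fun_prop

theorem cellPoint_zero : cellPoint z k m 0 = z k m := by
  ext
  simp [coe_cellPoint]

theorem cellPoint_one : cellPoint z k m 1 = z (k + 1) m := by
  ext
  simp [coe_cellPoint]

theorem le_cellPoint (h : z k m ≤ z (k + 1) m) (s : I) : z k m ≤ cellPoint z k m s := by
  rw [← Subtype.coe_le_coe] at h ⊢
  rw [coe_cellPoint]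
  linarith [mul_nonneg s.2.1 (sub_nonneg.2 h)]

theorem cellPoint_le (h : z k m ≤ z (k + 1) m) (s : I) : cellPoint z k m s ≤ z (k + 1) m := by
  rw [← Subtype.coe_le_coe] at h ⊢
  rw [coe_cellPoint]
  linarith [mul_nonneg (sub_nonneg.2 s.2.2) (sub_nonneg.2 h)]

theorem exists_cellPoint_eq {t : I} (h1 : z k m ≤ t) (h2 : t ≤ z (k + 1) m) :
    ∃ s, cellPoint z k m s = t := by
  obtain ⟨s, -, hs⟩ := intermediate_value_Icc (a := (0 : I)) (b := 1) zero_le_one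
    (continuous_cellPoint (z := z) (k := k) (m := m)).continuousOn
    (show t ∈ _ by rw [cellPoint_zero, cellPoint_one]; exact ⟨h1, h2⟩)
  exact ⟨s, hs⟩

theorem chain_le {N : ℕ} (h : ∀ j < N, z j m < z (j + 1) m) {i j : ℕ} (hij : i ≤ j) (hj : j ≤ N) :
    z i m ≤ z j m := by
  induction j, hij using Nat.le_induction with
  | base => exact le_rfl
  | succ j _ ih => exact (ih (by omega)).trans (h j (by omega)).le

/-- The segments between consecutive points of a finite chain cover the interval they span. -/
theorem exists_cell_of_mem {t : I} {k₀ N : ℕ} (hkN : k₀ ≤ N) (h1 : z k₀ m < t) (h2 : t ≤ z N m) :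
    ∃ k, k₀ ≤ k ∧ k < N ∧ ∃ s, cellPoint z k m s = t := by
  induction N, hkN using Nat.le_induction with
  | base => exact absurd h1 (not_lt.2 h2)
  | succ N hN ih =>
    rcases le_total t (z N m) with h | h
    · obtain ⟨k, hk, hkN, hs⟩ := ih h
      exact ⟨k, hk, hkN.trans N.lt_succ_self, hs⟩
    · exact ⟨N, hN, N.lt_succ_self, exists_cellPoint_eq h h2⟩

end Cells

section LayerCells

variable {u : Ultrafilter ℕ} {z : ℕ → ℕ → I}

theorem eventually_ge_of_free (hu : ∀ n : ℕ, u ≠ pure n) (N : ℕ) :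
    ∀ᶠ m in (u : Filter ℕ), N ≤ m := by
  rcases Ultrafilter.le_cofinite_or_eq_pure u with h | ⟨n, hn⟩
  · rw [Nat.cofinite_eq_atTop] at h
    exact h (eventually_ge_atTop N)
  · exact absurd hn (hu n)

/-- A decreasing sequence of members of a free ultrafilter is diagonalized by a function that tends
to infinity along it. -/
theorem exists_diagonal (hu : ∀ n : ℕ, u ≠ pure n) {P : ℕ → ℕ → Prop} (h0 : ∀ m, P m 0)
    (hP : ∀ N, ∀ᶠ m in (u : Filter ℕ), P m N) :
    ∃ K : ℕ → ℕ, (∀ m, P m (K m)) ∧ ∀ N, ∀ᶠ m in (u : Filter ℕ), N ≤ K m := by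
  classical
  refine ⟨fun m => Nat.findGreatest (P m) m, fun m => Nat.findGreatest_spec m.zero_le (h0 m),
    fun N => ?_⟩
  filter_upwards [hP N, eventually_ge_of_free hu N] with m hm hNm
  exact Nat.le_findGreatest hNm hm

theorem eventually_chain (hz : ∀ k, ∀ᶠ n in (u : Filter ℕ), z k n < z (k + 1) n) (N : ℕ) :
    ∀ᶠ m in (u : Filter ℕ), ∀ j < N, z j m < z (j + 1) m :=
  (Set.finite_lt_nat N).eventually_all.2 fun j _ => hz j

/-- Every neighbourhood of a point of the limit layer meets infinitely many of the intervals
between consecutive standard points. Otherwise diagonalizing would give a standard point above all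
`z k`, but below the given point. -/
theorem frequently_cell_of_mem_limitLayer (hu : ∀ n : ℕ, u ≠ pure n)
    (hz : ∀ k, ∀ᶠ n in (u : Filter ℕ), z k n < z (k + 1) n) {p : StoneCech Mspace}
    (hp : p ∈ limitLayer u z) {V : Set Mspace} (hV : ∀ᶠ x in trace p, x ∈ V) :
    ∃ᶠ k in atTop, ∀ᶠ m in (u : Filter ℕ), ∃ s, (m, cellPoint z k m s) ∈ V := by
  by_contra hcon
  rw [not_frequently, eventually_atTop] at hcon
  obtain ⟨k₀, hk₀⟩ := hcon
  -- The standard point given by `z (K m) m` is above all `z k`, and between `z k₀` and it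
  -- the set `V` is not met.
  obtain ⟨K, hK, hKtop⟩ := exists_diagonal hu
    (P := fun m N => (∀ j < N, z j m < z (j + 1) m) ∧
      ∀ k < N, k₀ ≤ k → ¬ ∃ s, (m, cellPoint z k m s) ∈ V) (by simp) (fun N => by
      refine (eventually_chain hz N).and ((Set.finite_lt_nat N).eventually_all.2 fun k _ => ?_)
      by_cases hk : k₀ ≤ k
      · exact (Ultrafilter.eventually_not.2 (hk₀ k hk)).mono fun m hm _ => hm
      · exact Eventually.of_forall fun m hm => absurd hm hk)
  have hlow : p ∈ lower fun m => z (K m) m := by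
    refine hp.2.2 _ fun k => ?_
    filter_upwards [hKtop k] with m hm
    exact chain_le (hK m).1 hm le_rfl
  have hnot : p ∉ lower (z k₀) := fun h =>
    not_mem_upper_of_mem_lower hp.1 (hz k₀) h (hp.2.1 (k₀ + 1))
  rw [mem_lower_iff, not_frequently] at hnot
  obtain ⟨⟨m, t⟩, ht, ht', htV, hm⟩ := ((mem_lower_iff.1 hlow).and_eventually
    (hnot.and (hV.and (eventually_trace_fst hp.1 (hKtop k₀))))).exists
  obtain ⟨k, hk, hkK, s, hs⟩ := exists_cell_of_mem hm (not_le.1 ht') ht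
  exact (hK m).2 k hkK hk ⟨s, hs ▸ htV⟩

/-- A closed set that meets infinitely many of the intervals between consecutive standard points
meets the limit layer, by compactness. -/
theorem limitLayer_inter_nonempty (hz : ∀ k, ∀ᶠ n in (u : Filter ℕ), z k n < z (k + 1) n)
    {C : Set (StoneCech Mspace)} (hC : IsClosed C)
    (h : ∃ᶠ k in atTop, ∀ᶠ m in (u : Filter ℕ),
      ∃ s, stoneCechUnit ((m, cellPoint z k m s) : Mspace) ∈ C) :
    (limitLayer u z ∩ C).Nonempty := by
  let T : ℕ ⊕ {t : ℕ → I // ∀ k, ∀ᶠ n in (u : Filter ℕ), z k n ≤ t n} →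
    Set (StoneCech Mspace) := Sum.elim (fun k => upper (z k)) (fun t => lower t.1)
  have hT : ∀ i, IsClosed (T i) := by
    rintro (k | t) <;> exact isClosed_closure
  obtain ⟨p, ⟨hp, hpC⟩, hpT⟩ := (isClosed_fiber (u := u)).inter hC |>.isCompact
    |>.inter_iInter_nonempty T hT (fun s => by
      have hev : ∀ᶠ k in atTop, ∀ i ∈ s, ∀ j, i = Sum.inl j → j ≤ k :=
        s.finite_toSet.eventually_all.2 fun i _ => by
          rcases i with j | t
          · filter_upwards [eventually_ge_atTop j] with k hk j' hj'
            rwa [← Sum.inl.inj hj']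
          · simp
      obtain ⟨k, hk, hks⟩ := (h.and_eventually hev).exists
      -- A standard point with values in the `k`-th segments and in `C`, for a large `k`.
      let t : ℕ → I := fun m => cellPoint z k m (Classical.epsilon fun s =>
        stoneCechUnit ((m, cellPoint z k m s) : Mspace) ∈ C)
      have ht : ∀ᶠ m in (u : Filter ℕ), stoneCechUnit ((m, t m) : Mspace) ∈ C :=
        hk.mono fun m hm => Classical.epsilon_spec hm
      refine ⟨standardPoint u t, ⟨standardPoint_mem_fiber t,
        standardPoint_mem_of_isClosed hC ht⟩, mem_iInter₂.2 fun i hi => ?_⟩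
      refine standardPoint_mem_of_isClosed (hT i) ?_
      rcases i with j | t'
      · filter_upwards [eventually_chain hz k, hz k] with m hm hm'
        exact subset_closure
          ⟨_, (chain_le hm (hks _ hi j rfl) le_rfl).trans (le_cellPoint hm'.le _), rfl⟩
      · filter_upwards [hz k, t'.2 (k + 1)] with m hm hm'
        exact subset_closure ⟨_, (cellPoint_le hm.le _).trans hm', rfl⟩)
  rw [mem_iInter] at hpT
  exact ⟨p, ⟨hp, fun k => hpT (Sum.inl k), fun t ht => hpT (Sum.inr ⟨t, ht⟩)⟩, hpC⟩

end LayerCells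

section HalfLine

/-- The function `t ↦ 1 / (1 + t)` on the half line; its extension to `βℍ` vanishes exactly on
the remainder. -/
def decay (t : ℝ≥0) : I := ⟨1 / (1 + (t : ℝ)), by positivity, by
  rw [div_le_one (by positivity)]; linarith [t.2]⟩

theorem continuous_decay : Continuous decay := by
  unfold decay
  refine Continuous.subtype_mk (continuous_const.div (by fun_prop) fun t => ?_) _
  positivity

/-- Points of the remainder are far out, as bounded intervals of the half line are compact. -/
theorem eventually_trace_gt {q : StoneCech ℝ≥0} (hq : q ∈ remainder ℝ≥0) (K : ℝ≥0) :
    ∀ᶠ x in trace q, K < x := by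
  have hcl : IsClosed (stoneCechUnit '' Icc (0 : ℝ≥0) K) :=
    (isCompact_Icc.image continuous_stoneCechUnit).isClosed
  have hmem : (stoneCechUnit '' Icc (0 : ℝ≥0) K)ᶜ ∈ 𝓝 q :=
    hcl.isOpen_compl.mem_nhds fun ⟨x, _, hx⟩ => hq ⟨x, hx⟩
  filter_upwards [(tendsto_trace q).eventually hmem] with x hx
  by_contra hKx
  exact hx ⟨x, ⟨zero_le, not_lt.1 hKx⟩, rfl⟩

theorem tendsto_decay : Tendsto decay atTop (𝓝 0) := by
  rw [tendsto_subtype_rng]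
  have h : Tendsto (fun t : ℝ≥0 => 1 + (t : ℝ)) atTop atTop :=
    tendsto_atTop_add_const_left _ _ (NNReal.tendsto_coe_atTop.2 tendsto_id)
  simpa [decay, Function.comp_def] using tendsto_inv_atTop_zero.comp h

theorem decay_ne_zero (t : ℝ≥0) : decay t ≠ 0 := by
  intro h
  have h1 : 1 / (1 + (t : ℝ)) = 0 := congrArg Subtype.val h
  have : 0 < 1 / (1 + (t : ℝ)) := by positivity
  exact this.ne' h1

theorem mem_remainder_iff {q : StoneCech ℝ≥0} :
    q ∈ remainder ℝ≥0 ↔ stoneCechExtend continuous_decay q = 0 := by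
  constructor
  · intro hq
    have h1 := ((continuous_stoneCechExtend continuous_decay).tendsto q).comp (tendsto_trace q)
    rw [stoneCechExtend_extends] at h1
    refine tendsto_nhds_unique h1 (tendsto_decay.mono_left ?_)
    intro S hS
    obtain ⟨K, hK⟩ := mem_atTop_sets.1 hS
    filter_upwards [eventually_trace_gt hq K] with x hx
    exact hK x hx.le
  · rintro hq ⟨x, rfl⟩
    rw [stoneCechExtend_stoneCechUnit] at hq
    exact decay_ne_zero x hq

theorem isClosed_remainder : IsClosed (remainder ℝ≥0) := by
  have : remainder ℝ≥0 = stoneCechExtend continuous_decay ⁻¹' {0} := by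
    ext q
    exact mem_remainder_iff
  rw [this]
  exact isClosed_singleton.preimage (continuous_stoneCechExtend _)

theorem frequently_cell_of_mem_remainder {q : StoneCech ℝ≥0} (hq : q ∈ remainder ℝ≥0)
    {V : Set ℝ≥0} (hV : ∀ᶠ x in trace q, x ∈ V) :
    ∃ᶠ k : ℕ in atTop, ∃ s : I, (k : ℝ≥0) + unitInterval.toNNReal s ∈ V := by
  rw [frequently_atTop]
  intro K
  obtain ⟨x, hxV, hxK⟩ := (hV.and (eventually_trace_gt hq K)).exists
  have hfl := Nat.floor_le (zero_le (a := x))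
  have hfl' := Nat.lt_floor_add_one x
  refine ⟨⌊x⌋₊, Nat.le_floor hxK.le, ⟨(x : ℝ) - ⌊x⌋₊, ?_, ?_⟩, ?_⟩
  · have : ((⌊x⌋₊ : ℝ≥0) : ℝ) ≤ x := NNReal.coe_le_coe.2 hfl
    simpa using this
  · have : (x : ℝ) < ((⌊x⌋₊ + 1 : ℝ≥0) : ℝ) := NNReal.coe_lt_coe.2 hfl'
    push_cast at this
    linarith
  · convert hxV using 1
    ext
    simp

theorem remainder_inter_nonempty {C : Set (StoneCech ℝ≥0)} (hC : IsClosed C)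
    (h : ∃ᶠ k : ℕ in atTop, ∃ s : I, stoneCechUnit ((k : ℝ≥0) + unitInterval.toNNReal s) ∈ C) :
    (remainder ℝ≥0 ∩ C).Nonempty := by
  have hex : ∀ N : ℕ, ∃ x : ℝ≥0, (N : ℝ≥0) ≤ x ∧ stoneCechUnit x ∈ C := by
    intro N
    obtain ⟨k, hk, s, hs⟩ := frequently_atTop.1 h N
    exact ⟨_, (Nat.cast_le.2 hk).trans (le_add_of_nonneg_right zero_le), hs⟩
  choose x hx hxC using hex
  let q := Ultrafilter.extend (fun n => stoneCechUnit (x n)) (hyperfilter ℕ)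
  have hq : Tendsto (fun n => stoneCechUnit (x n)) (hyperfilter ℕ) (𝓝 q) :=
    ultrafilter_extend_eq_iff.1 rfl
  refine ⟨q, mem_remainder_iff.2 ?_, hC.mem_of_tendsto hq (Eventually.of_forall hxC)⟩
  have h1 := ((continuous_stoneCechExtend continuous_decay).tendsto q).comp hq
  refine tendsto_nhds_unique h1 ?_
  have hxtop : Tendsto x atTop atTop := tendsto_atTop_mono hx tendsto_natCast_atTop_atTop
  convert (tendsto_decay.comp hxtop).mono_left Nat.hyperfilter_le_atTop using 1
  ext1 n
  exact stoneCechExtend_stoneCechUnit _ _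

end HalfLine

/-! ### Gluing maps of the unit interval -/

section Gluing

/-- The map `φ k`, corrected by a linear term so that its value at `1` becomes the value of
`φ (k + 1)` at `0`, and truncated to `I`. -/
def adjusted (φ : ℕ → C(I, I)) (k : ℕ) (s : I) : I :=
  projIcc 0 1 zero_le_one ((φ k s : ℝ) + s * ((φ (k + 1) 0 : ℝ) - φ k 1))

variable (φ : ℕ → C(I, I)) (k : ℕ)

theorem continuous_adjusted : Continuous (adjusted φ k) := by
  unfold adjusted
  exact continuous_projIcc.comp (by fun_prop)

theorem adjusted_zero : adjusted φ k 0 = φ k 0 := by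
  simp [adjusted, projIcc_val]

theorem adjusted_one : adjusted φ k 1 = φ (k + 1) 0 := by
  simp [adjusted, projIcc_val]

theorem dist_adjusted_le (s : I) : dist (φ k s) (adjusted φ k s) ≤ dist (φ k 1) (φ (k + 1) 0) := by
  have h1 := abs_projIcc_sub_projIcc (zero_le_one (α := ℝ)) (c := (φ k s : ℝ))
    (d := (φ k s : ℝ) + s * ((φ (k + 1) 0 : ℝ) - φ k 1))
  rw [projIcc_val] at h1
  have h2 : |(φ k s : ℝ) - ((φ k s : ℝ) + s * ((φ (k + 1) 0 : ℝ) - φ k 1))| =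
      s * |(φ k 1 : ℝ) - φ (k + 1) 0| := by
    rw [← abs_of_nonneg s.2.1, ← abs_mul, abs_of_nonneg s.2.1]
    congr 1
    ring
  rw [Subtype.dist_eq, Real.dist_eq, Subtype.dist_eq, Real.dist_eq]
  exact h1.trans (h2.trans_le (mul_le_of_le_one_left (abs_nonneg _) s.2.2))

theorem locallyFinite_Icc_natCast :
    LocallyFinite fun k : ℕ => Icc (k : ℝ≥0) (k + 1) := by
  intro x
  refine ⟨Iio (x + 1), Iio_mem_nhds (lt_add_of_pos_right x one_pos), ?_⟩
  refine (Set.finite_le_nat ⌊x + 1⌋₊).subset ?_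
  rintro k ⟨y, hy1, hy2⟩
  exact Nat.le_floor (hy1.1.trans (le_of_lt hy2))

/-- Maps on the unit interval can be strung together to a map on the half line; on the `k`-th
interval the error is at most the mismatch at the right end point. -/
theorem exists_glued : ∃ f : C(ℝ≥0, I), ∀ (k : ℕ) (s : I),
    dist (φ k s) (f ((k : ℝ≥0) + unitInterval.toNNReal s)) ≤ dist (φ k 1) (φ (k + 1) 0) := by
  let piece : ℕ → ℝ≥0 → I := fun k x =>
    adjusted φ k (projIcc 0 1 zero_le_one ((x : ℝ) - k))
  have hpiece : ∀ k, Continuous (piece k) := fun k =>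
    (continuous_adjusted φ k).comp (continuous_projIcc.comp (by fun_prop))
  let f : ℝ≥0 → I := fun x => piece ⌊x⌋₊ x
  have hf : ∀ (k : ℕ), ∀ x ∈ Icc (k : ℝ≥0) (k + 1), f x = piece k x := by
    intro k x hx
    rcases hx.2.lt_or_eq with hlt | heq
    · have : ⌊x⌋₊ = k := (Nat.floor_eq_iff zero_le).2 ⟨hx.1, hlt⟩
      simp only [f, this]
    · have : ⌊x⌋₊ = k + 1 := by
        rw [heq]
        exact_mod_cast Nat.floor_natCast (k + 1)
      change piece ⌊x⌋₊ x = piece k x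
      rw [this]
      simp only [piece, heq]
      have e1 : projIcc (0 : ℝ) 1 zero_le_one
          ((((k : ℝ≥0) + 1 : ℝ≥0) : ℝ) - ((k + 1 : ℕ) : ℝ)) = 0 :=
        projIcc_of_le_left _ (by push_cast; simp)
      have e2 : projIcc (0 : ℝ) 1 zero_le_one ((((k : ℝ≥0) + 1 : ℝ≥0) : ℝ) - (k : ℝ)) = 1 :=
        projIcc_of_right_le _ (by push_cast; simp)
      rw [e1, e2, adjusted_zero, adjusted_one]
  have hcont : Continuous f := by
    refine locallyFinite_Icc_natCast.continuous ?_ (fun k => isClosed_Icc)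
      (fun k => (hpiece k).continuousOn.congr (hf k))
    refine eq_univ_of_forall fun x => mem_iUnion.2 ⟨⌊x⌋₊, Nat.floor_le zero_le, ?_⟩
    exact (Nat.lt_floor_add_one x).le
  refine ⟨⟨f, hcont⟩, fun k s => ?_⟩
  have hs : (k : ℝ≥0) + unitInterval.toNNReal s ∈ Icc (k : ℝ≥0) (k + 1) :=
    ⟨le_add_of_nonneg_right zero_le, by gcongr; exact s.2.2⟩
  have : f ((k : ℝ≥0) + unitInterval.toNNReal s) = adjusted φ k s := by
    rw [hf k _ hs]
    simp only [piece]
    congr 1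
    convert projIcc_val (zero_le_one (α := ℝ)) s using 2
    push_cast
    simp
  change dist _ (f _) ≤ _
  rw [this]
  exact dist_adjusted_le φ k s

/-- A map from `I` to the half line that stretches each of finitely many consecutive segments to
an interval of length `1`. -/
theorem exists_stretch {z : ℕ → ℕ → I} {m N : ℕ} (h : ∀ j < N, z j m < z (j + 1) m) :
    ∃ θ : C(I, ℝ≥0), (∀ k < N, ∀ s, θ (cellPoint z k m s) = (k : ℝ≥0) + unitInterval.toNNReal s) ∧
      ∀ t, z N m ≤ t → θ t = N := by
  induction N with
  | zero => exact ⟨⟨fun _ => 0, continuous_const⟩, by simp, by simp⟩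
  | succ N ih =>
    obtain ⟨θ, h1, h2⟩ := ih fun j hj => h j (hj.trans N.lt_succ_self)
    have hN := h N N.lt_succ_self
    have hN' : (0 : ℝ) < z (N + 1) m - z N m := sub_pos.2 hN
    let c : I → I := fun t =>
      projIcc 0 1 zero_le_one (((t : ℝ) - z N m) / (z (N + 1) m - z N m))
    have hc : Continuous c := continuous_projIcc.comp (by fun_prop)
    refine ⟨⟨fun t => θ t + unitInterval.toNNReal (c t), ?_⟩, fun k hk s => ?_, fun t ht => ?_⟩
    · exact θ.continuous.add (unitInterval.toNNReal_continuous.comp hc)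
    · rw [ContinuousMap.coe_mk]
      rcases Nat.lt_succ_iff_lt_or_eq.1 hk with hk' | rfl
      · have hle : cellPoint z k m s ≤ z N m := (cellPoint_le (h k hk).le s).trans
          (chain_le h (show k + 1 ≤ N from hk') N.le_succ)
        have : c (cellPoint z k m s) = 0 := projIcc_of_le_left _
          (div_nonpos_of_nonpos_of_nonneg (sub_nonpos.2 hle) hN'.le)
        rw [h1 k hk' s, this, unitInterval.toNNReal_zero, add_zero]
      · have : c (cellPoint z k m s) = s := by
          convert projIcc_val (zero_le_one (α := ℝ)) s using 2
          rw [coe_cellPoint]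
          field_simp
          ring
        rw [h2 _ (le_cellPoint hN.le s), this]
    · have : c t = 1 := projIcc_of_right_le _ (by
        rw [one_le_div hN']
        exact sub_le_sub_right (show (z (N + 1) m : ℝ) ≤ t from ht) _)
      rw [ContinuousMap.coe_mk, h2 t (hN.le.trans ht), this, unitInterval.toNNReal_one]
      push_cast
      rfl

variable {u : Ultrafilter ℕ} {z : ℕ → ℕ → I}

/-- A double sequence of maps whose consecutive terms nearly fit together along `u` comes
from a function on `𝕄`, up to an asymptotically small error. -/
theorem exists_glued_Mspace (hu : ∀ n : ℕ, u ≠ pure n)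
    (hz : ∀ k, ∀ᶠ n in (u : Filter ℕ), z k n < z (k + 1) n) (g : ℕ → ℕ → C(I, I))
    (hg : ∀ ε > 0, ∀ᶠ k in atTop, ∀ᶠ m in (u : Filter ℕ), dist (g k m 1) (g (k + 1) m 0) < ε) :
    ∃ h : C(Mspace, I), ∀ ε > 0, ∀ᶠ k in atTop, ∀ᶠ m in (u : Filter ℕ), ∀ s,
      dist (g k m s) (h (m, cellPoint z k m s)) < ε := by
  -- For fixed `m`, glue the `g k m` to a map on the half line and pull it back to `I` along a map
  -- that stretches the first `K m` segments to unit intervals.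
  choose G hG using fun m => exists_glued (fun k => g k m)
  obtain ⟨K, hK, hKtop⟩ := exists_diagonal hu
    (P := fun m N => ∀ j < N, z j m < z (j + 1) m) (by simp) (eventually_chain hz)
  choose θ hθ _ using fun m => exists_stretch (hK m)
  refine ⟨⟨fun x => G x.1 (θ x.1 x.2), ?_⟩, fun ε hε => ?_⟩
  · rw [continuous_prod_of_discrete_left]
    exact fun m => (G m).continuous.comp (θ m).continuous
  · filter_upwards [hg ε hε] with k hk
    filter_upwards [hk, hKtop (k + 1)] with m hm hKm s
    refine lt_of_le_of_lt ?_ hm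
    change dist (g k m s) (G m (θ m (cellPoint z k m s))) ≤ _
    rw [hθ m k hKm s]
    exact hG m k s

end Gluing

/-! ### The homeomorphism -/

section Homeomorphism

/-- Two compact spaces are homeomorphic if they have families of continuous functions, indexed by
the same set and separating points, that approximately attain the same finite tuples of values:
the two spaces are embedded onto the same closed subset of a Tychonoff cube. -/
theorem nonempty_homeomorph_of_approx {X Y ι : Type*} [TopologicalSpace X] [TopologicalSpace Y]
    [CompactSpace X] [CompactSpace Y] (h : ι → C(X, I)) (f : ι → C(Y, I))
    (hsep : ∀ x x', (∀ i, h i x = h i x') → x = x') (fsep : ∀ y y', (∀ i, f i y = f i y') → y = y')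
    (hf : ∀ (s : Finset ι) (ε : ℝ), 0 < ε → ∀ x, ∃ y, ∀ i ∈ s, dist (h i x) (f i y) ≤ ε)
    (fh : ∀ (s : Finset ι) (ε : ℝ), 0 < ε → ∀ y, ∃ x, ∀ i ∈ s, dist (h i x) (f i y) ≤ ε) :
    Nonempty (X ≃ₜ Y) := by
  have hemb : IsClosedEmbedding fun (x : X) (i : ι) => h i x :=
    Continuous.isClosedEmbedding (continuous_pi fun i => (h i).continuous)
      fun x x' hxx => hsep x x' (congrFun hxx)
  have femb : IsClosedEmbedding fun (y : Y) (i : ι) => f i y :=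
    Continuous.isClosedEmbedding (continuous_pi fun i => (f i).continuous)
      fun y y' hyy => fsep y y' (congrFun hyy)
  have key : ∀ (S : Set (ι → I)) (v : ι → I), IsClosed S →
      (∀ (s : Finset ι) (ε : ℝ), 0 < ε → ∃ w ∈ S, ∀ i ∈ s, dist (w i) (v i) ≤ ε) → v ∈ S := by
    intro S v hS hv
    have hbasis := hasBasis_pi fun i => Metric.nhds_basis_closedBall (x := v i)
    rw [← nhds_pi] at hbasis
    rw [← hS.closure_eq, mem_closure_iff_nhds_basis hbasis]
    rintro ⟨s, r⟩ ⟨hs, hr⟩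
    rcases s.eq_empty_or_nonempty with rfl | hne
    · obtain ⟨w, hw, -⟩ := hv ∅ 1 one_pos
      exact ⟨w, hw, by simp⟩
    · have hne' : hs.toFinset.Nonempty := by simpa using hne
      obtain ⟨w, hw, hw'⟩ := hv hs.toFinset (hs.toFinset.inf' hne' r)
        ((Finset.lt_inf'_iff _).2 fun i hi => hr i (hs.mem_toFinset.1 hi))
      exact ⟨w, hw, fun i hi => (hw' i (hs.mem_toFinset.2 hi)).trans
        (Finset.inf'_le _ (hs.mem_toFinset.2 hi))⟩
  have hrange : range (fun (x : X) (i : ι) => h i x) = range fun (y : Y) (i : ι) => f i y := by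
    refine Subset.antisymm ?_ ?_
    · rintro _ ⟨x, rfl⟩
      refine key _ _ femb.isClosed_range fun s ε hε => ?_
      obtain ⟨y, hy⟩ := hf s ε hε x
      exact ⟨_, ⟨y, rfl⟩, fun i hi => by rw [dist_comm]; exact hy i hi⟩
    · rintro _ ⟨y, rfl⟩
      refine key _ _ hemb.isClosed_range fun s ε hε => ?_
      obtain ⟨x, hx⟩ := fh s ε hε y
      exact ⟨_, ⟨x, rfl⟩, hx⟩
  exact ⟨hemb.isEmbedding.toHomeomorph.trans ((Homeomorph.setCongr hrange).trans
    femb.isEmbedding.toHomeomorph.symm)⟩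

end Homeomorphism

section Layer

variable {u : Ultrafilter ℕ} {z : ℕ → ℕ → I}

/-- The maps `φ k` approximate a function on `βℍ` on the unit intervals of the half line, with an
error that tends to `0`. -/
def ApproxHalfLine (f : C(StoneCech ℝ≥0, I)) (φ : ℕ → C(I, I)) : Prop :=
  ∀ ε > 0, ∀ᶠ k in atTop, ∀ s,
    dist (φ k s) (f (stoneCechUnit ((k : ℝ≥0) + unitInterval.toNNReal s))) < ε

/-- The maps `g k m` approximate a function on `β𝕄` on the segments between consecutive standard
points, with an error that tends to `0`. -/
def ApproxLayer (u : Ultrafilter ℕ) (z : ℕ → ℕ → I) (h : C(StoneCech Mspace, I))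
    (g : ℕ → ℕ → C(I, I)) : Prop :=
  ∀ ε > 0, ∀ᶠ k in atTop, ∀ᶠ m in (u : Filter ℕ), ∀ s,
    dist (g k m s) (h (stoneCechUnit ((m, cellPoint z k m s) : Mspace))) < ε

theorem exists_approxHalfLine {φ : ℕ → C(I, I)}
    (hφ : ∀ ε > 0, ∀ᶠ k in atTop, dist (φ k 1) (φ (k + 1) 0) < ε) :
    ∃ f, ApproxHalfLine f φ := by
  obtain ⟨f, hf⟩ := exists_glued φ
  refine ⟨⟨_, continuous_stoneCechExtend f.continuous⟩, fun ε hε => ?_⟩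
  filter_upwards [hφ ε hε] with k hk s
  change dist (φ k s) (stoneCechExtend f.continuous _) < ε
  rw [stoneCechExtend_stoneCechUnit]
  exact (hf k s).trans_lt hk

theorem exists_approxLayer (hu : ∀ n : ℕ, u ≠ pure n)
    (hz : ∀ k, ∀ᶠ n in (u : Filter ℕ), z k n < z (k + 1) n) {g : ℕ → ℕ → C(I, I)}
    (hg : ∀ ε > 0, ∀ᶠ k in atTop, ∀ᶠ m in (u : Filter ℕ), dist (g k m 1) (g (k + 1) m 0) < ε) :
    ∃ h, ApproxLayer u z h g := by
  obtain ⟨h, hh⟩ := exists_glued_Mspace hu hz g hg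
  refine ⟨⟨_, continuous_stoneCechExtend h.continuous⟩, fun ε hε => ?_⟩
  filter_upwards [hh ε hε] with k hk
  filter_upwards [hk] with m hm s
  change dist (g k m s) (stoneCechExtend h.continuous _) < ε
  rw [stoneCechExtend_stoneCechUnit]
  exact hm s

variable {W : Type} {F : W → (ℕ → C(I, I)) × (ℕ → ℕ → C(I, I))}

/-- The partner of the restrictions of a function on `β𝕄` comes from a function on `βℍ`: the
restrictions to consecutive segments agree at the common end point, and a matching approximately
preserves values at end points. -/
theorem IsMatching.exists_approxHalfLine (hF : IsMatching u F) (w : W)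
    {h : C(StoneCech Mspace, I)}
    (hw : (F w).2 = fun k m => ⟨fun s => h (stoneCechUnit ((m, cellPoint z k m s) : Mspace)),
      h.continuous.comp (continuous_stoneCechUnit.comp
        (continuous_const.prodMk continuous_cellPoint))⟩) :
    ∃ f, ApproxHalfLine f (F w).1 := by
  refine StandardContinuum.exists_approxHalfLine fun ε hε => ?_
  have h1 := hF.eventually_dist_endpoint w 1 1 rfl (half_pos hε)
  have h0 := hF.eventually_dist_endpoint w 0 0 rfl (half_pos hε)
  filter_upwards [h1, (tendsto_add_atTop_nat 1).eventually h0] with k hk1 hk0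
  obtain ⟨m, hm1, hm0⟩ := (hk1.and hk0).exists
  have heq : (F w).2 k m 1 = (F w).2 (k + 1) m 0 := by
    rw [hw]
    simp only [ContinuousMap.coe_mk, cellPoint_one, cellPoint_zero]
  rw [heq] at hm1
  rw [dist_comm] at hm0
  linarith [dist_triangle ((F w).1 k 1) ((F w).2 (k + 1) m 0) ((F w).1 (k + 1) 0)]

/-- The partner of the restrictions of a function on `βℍ` comes from a function on `β𝕄`. -/
theorem IsMatching.exists_approxLayer (hF : IsMatching u F) (hu : ∀ n : ℕ, u ≠ pure n)
    (hz : ∀ k, ∀ᶠ n in (u : Filter ℕ), z k n < z (k + 1) n) (w : W)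
    {f : C(StoneCech ℝ≥0, I)}
    (hw : (F w).1 = fun k => ⟨fun s =>
      f (stoneCechUnit ((k : ℝ≥0) + unitInterval.toNNReal s)),
      f.continuous.comp (continuous_stoneCechUnit.comp
        (continuous_const.add unitInterval.toNNReal_continuous))⟩) :
    ∃ h, ApproxLayer u z h (F w).2 := by
  refine StandardContinuum.exists_approxLayer hu hz fun ε hε => ?_
  have h1 := hF.eventually_dist_endpoint w 1 1 rfl (half_pos hε)
  have h0 := hF.eventually_dist_endpoint w 0 0 rfl (half_pos hε)
  filter_upwards [h1, (tendsto_add_atTop_nat 1).eventually h0] with k hk1 hk0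
  have heq : (F w).1 k 1 = (F w).1 (k + 1) 0 := by
    rw [hw]
    simp
  filter_upwards [hk1, hk0] with m hm1 hm0
  rw [heq, dist_comm] at hm1
  linarith [dist_triangle ((F w).2 k m 1) ((F w).1 (k + 1) 0) ((F w).2 (k + 1) m 0)]

/-- A rational interval between two neighbourhoods of `r`. -/
theorem exists_rat_cell (r : I) {ε : ℝ} (hε : 0 < ε) : ∃ c : ℚ × ℚ,
    (∀ x : I, dist x r < 2 * ε → (c.1 : ℝ) < x ∧ (x : ℝ) < c.2) ∧
      ∀ x : I, (c.1 : ℝ) < x → (x : ℝ) < c.2 → dist x r < 3 * ε := by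
  obtain ⟨a, ha, ha'⟩ := exists_rat_btwn (show (r : ℝ) - 3 * ε < r - 2 * ε by linarith)
  obtain ⟨b, hb, hb'⟩ := exists_rat_btwn (show (r : ℝ) + 2 * ε < r + 3 * ε by linarith)
  refine ⟨(a, b), fun x hx => ?_, fun x h1 h2 => ?_⟩
  · rw [Subtype.dist_eq, Real.dist_eq, abs_lt] at hx
    constructor <;> simp only <;> linarith [hx.1, hx.2]
  · rw [Subtype.dist_eq, Real.dist_eq, abs_lt]
    simp only at h1 h2
    constructor <;> linarith

theorem IsMatching.eventually_iff (hF : IsMatching u F) {ι : Type} [Finite ι] (t : ι → W)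
    (c : ι → ℚ × ℚ) : ∀ᶠ k in atTop,
    ((∃ x, ∀ i, ((c i).1 : ℝ) < (F (t i)).1 k x ∧ ((F (t i)).1 k x : ℝ) < (c i).2) ↔
      ∀ᶠ m in (u : Filter ℕ), ∃ x, ∀ i, ((c i).1 : ℝ) < (F (t i)).2 k m x ∧
        ((F (t i)).2 k m x : ℝ) < (c i).2) := by
  obtain ⟨n, ⟨e⟩⟩ := Finite.exists_equiv_fin ι
  filter_upwards [hF n (t ∘ e.symm) 2 (c ∘ e.symm)] with k hk
  have h2 : cellPart 2 = univ := rfl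
  simpa [h2, e.symm.forall_congr_left] using hk

variable {ι : Type} [Finite ι] {t : ι → W} {h : ι → C(StoneCech Mspace, I)}
  {f : ι → C(StoneCech ℝ≥0, I)}

/-- Finitely many values at a point of the limit layer are approximately the values of the partner
functions at a point of `ℍ*`: the values are approached on infinitely many segments, this is
a pattern that the matching transfers to the half line, and compactness gives the point. -/
theorem IsMatching.exists_mem_remainder (hF : IsMatching u F) (hu : ∀ n : ℕ, u ≠ pure n)
    (hz : ∀ k, ∀ᶠ n in (u : Filter ℕ), z k n < z (k + 1) n)
    (hh : ∀ i, ApproxLayer u z (h i) (F (t i)).2) (hf : ∀ i, ApproxHalfLine (f i) (F (t i)).1)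
    {p : StoneCech Mspace} (hp : p ∈ limitLayer u z) {ε : ℝ} (hε : 0 < ε) :
    ∃ q ∈ remainder ℝ≥0, ∀ i, dist (h i p) (f i q) ≤ 4 * ε := by
  choose c hc hc' using fun i => exists_rat_cell (h i p) hε
  have hV : ∀ᶠ x in trace p, x ∈ {x : Mspace | ∀ i, dist (h i (stoneCechUnit x)) (h i p) < ε} :=
    eventually_all.2 fun i => (((h i).continuous.tendsto p).comp (tendsto_trace p)).eventually
      (Metric.ball_mem_nhds _ hε)
  obtain ⟨q, hq, hqC⟩ := remainder_inter_nonempty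
    (C := {q | ∀ i, dist (h i p) (f i q) ≤ 4 * ε})
    (by
      simp only [ofPred_forall]
      exact isClosed_iInter fun i =>
        isClosed_le (continuous_const.dist (f i).continuous) continuous_const)
    (by
      have hA := eventually_all.2 fun i => hh i ε hε
      have hB := eventually_all.2 fun i => hf i ε hε
      refine ((frequently_cell_of_mem_limitLayer hu hz hp hV).and_eventually
        (hA.and (hB.and (hF.eventually_iff t c)))).mono fun k ⟨hk, hkA, hkB, hkF⟩ => ?_
      obtain ⟨s, hs⟩ := hkF.2 (by
        filter_upwards [hk, eventually_all.2 hkA] with m ⟨s, hs⟩ hmA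
        refine ⟨s, fun i => hc i _ ?_⟩
        have h1 := hmA i s
        have h2 := hs i
        linarith [dist_triangle ((F (t i)).2 k m s)
          (h i (stoneCechUnit ((m, cellPoint z k m s) : Mspace))) (h i p)])
      refine ⟨s, fun i => ?_⟩
      have h1 := hc' i _ (hs i).1 (hs i).2
      have h2 := hkB i s
      rw [dist_comm] at h1
      linarith [dist_triangle (h i p) ((F (t i)).1 k s)
        (f i (stoneCechUnit ((k : ℝ≥0) + unitInterval.toNNReal s)))])
  exact ⟨q, hq, hqC⟩

/-- Finitely many values at a point of `ℍ*` are approximately the values of the partner functions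
at a point of the limit layer. -/
theorem IsMatching.exists_mem_limitLayer (hF : IsMatching u F)
    (hz : ∀ k, ∀ᶠ n in (u : Filter ℕ), z k n < z (k + 1) n)
    (hh : ∀ i, ApproxLayer u z (h i) (F (t i)).2) (hf : ∀ i, ApproxHalfLine (f i) (F (t i)).1)
    {q : StoneCech ℝ≥0} (hq : q ∈ remainder ℝ≥0) {ε : ℝ} (hε : 0 < ε) :
    ∃ p ∈ limitLayer u z, ∀ i, dist (h i p) (f i q) ≤ 4 * ε := by
  choose c hc hc' using fun i => exists_rat_cell (f i q) hε
  have hV : ∀ᶠ x in trace q, x ∈ {x : ℝ≥0 | ∀ i, dist (f i (stoneCechUnit x)) (f i q) < ε} :=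
    eventually_all.2 fun i => (((f i).continuous.tendsto q).comp (tendsto_trace q)).eventually
      (Metric.ball_mem_nhds _ hε)
  obtain ⟨p, hp, hpC⟩ := limitLayer_inter_nonempty hz
    (C := {p | ∀ i, dist (h i p) (f i q) ≤ 4 * ε})
    (by
      simp only [ofPred_forall]
      exact isClosed_iInter fun i =>
        isClosed_le ((h i).continuous.dist continuous_const) continuous_const)
    (by
      have hA := eventually_all.2 fun i => hh i ε hε
      have hB := eventually_all.2 fun i => hf i ε hε
      refine ((frequently_cell_of_mem_remainder hq hV).and_eventually
        (hA.and (hB.and (hF.eventually_iff t c)))).mono fun k ⟨hk, hkA, hkB, hkF⟩ => ?_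
      obtain ⟨s, hs⟩ := hk
      filter_upwards [hkF.1 ⟨s, fun i => hc i _ (by
        have h1 := hkB i s
        have h2 := hs i
        linarith [dist_triangle ((F (t i)).1 k s)
          (f i (stoneCechUnit ((k : ℝ≥0) + unitInterval.toNNReal s))) (f i q)])⟩,
        eventually_all.2 hkA] with m ⟨s', hs'⟩ hmA
      refine ⟨s', fun i => ?_⟩
      have h1 := hc' i _ (hs' i).1 (hs' i).2
      have h2 := hmA i s'
      rw [dist_comm] at h2
      linarith [dist_triangle (h i (stoneCechUnit ((m, cellPoint z k m s') : Mspace)))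
        ((F (t i)).2 k m s') (f i q)])
  exact ⟨p, hp, hpC⟩

theorem exists_unitInterval_map_ne {X : Type*} [TopologicalSpace X] [NormalSpace X] [T1Space X]
    {x y : X} (hxy : x ≠ y) : ∃ f : C(X, I), f x ≠ f y := by
  obtain ⟨f, h0, h1, hf⟩ := exists_continuous_zero_one_of_isClosed (isClosed_singleton (x := x))
    (isClosed_singleton (x := y)) (disjoint_singleton.2 hxy)
  refine ⟨⟨fun x => ⟨f x, hf x⟩, f.continuous.subtype_mk _⟩, fun h => ?_⟩
  have := congrArg Subtype.val h
  simp [h0 (mem_singleton x), h1 (mem_singleton y)] at this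

/-- Under the Continuum Hypothesis the limit layer is homeomorphic to the remainder of the half
line. -/
theorem nonempty_limitLayer_homeomorph
    (hCH : Cardinal.aleph 1 = (Cardinal.continuum : Cardinal.{0}))
    (hu : ∀ n : ℕ, u ≠ pure n) (hz : ∀ k, ∀ᶠ n in (u : Filter ℕ), z k n < z (k + 1) n) :
    Nonempty (limitLayer u z ≃ₜ remainder ℝ≥0) := by
  obtain ⟨W, F, hF, hF1, hF2⟩ := exists_isMatching hCH u
  -- All pairs of functions on `β𝕄` and `βℍ` that are approximated by the two halves of some `F w`.
  let κ : Type := {x : W × C(StoneCech Mspace, I) × C(StoneCech ℝ≥0, I) //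
    ApproxLayer u z x.2.1 (F x.1).2 ∧ ApproxHalfLine x.2.2 (F x.1).1}
  have := isCompact_iff_compactSpace.1 (isClosed_limitLayer (u := u) z).isCompact
  have := isCompact_iff_compactSpace.1 isClosed_remainder.isCompact
  refine nonempty_homeomorph_of_approx (ι := κ)
    (fun i => i.1.2.1.comp ⟨Subtype.val, continuous_subtype_val⟩)
    (fun i => i.1.2.2.comp ⟨Subtype.val, continuous_subtype_val⟩) ?_ ?_ ?_ ?_
  · intro x x' hxx
    by_contra hne
    obtain ⟨h, hh⟩ := exists_unitInterval_map_ne (Subtype.coe_ne_coe.2 hne)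
    obtain ⟨w, hw⟩ := hF2 fun k m =>
      ⟨fun s => h (stoneCechUnit ((m, cellPoint z k m s) : Mspace)),
        h.continuous.comp (continuous_stoneCechUnit.comp
          (continuous_const.prodMk continuous_cellPoint))⟩
    obtain ⟨f, hf⟩ := hF.exists_approxHalfLine w hw
    refine hh (hxx ⟨(w, h, f), fun ε hε => ?_, hf⟩)
    refine Eventually.of_forall fun k => Eventually.of_forall fun m s => ?_
    rw [hw]
    simpa using hε
  · intro y y' hyy
    by_contra hne
    obtain ⟨f, hf⟩ := exists_unitInterval_map_ne (Subtype.coe_ne_coe.2 hne)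
    obtain ⟨w, hw⟩ := hF1 fun k =>
      ⟨fun s => f (stoneCechUnit ((k : ℝ≥0) + unitInterval.toNNReal s)),
        f.continuous.comp (continuous_stoneCechUnit.comp
          (continuous_const.add unitInterval.toNNReal_continuous))⟩
    obtain ⟨h, hh⟩ := hF.exists_approxLayer hu hz w hw
    refine hf (hyy ⟨(w, h, f), hh, fun ε hε => ?_⟩)
    refine Eventually.of_forall fun k s => ?_
    rw [hw]
    simpa using hε
  · intro s ε hε x
    obtain ⟨q, hq, hq'⟩ := hF.exists_mem_remainder hu hz (t := fun i : s => i.1.1.1)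
      (fun i => i.1.2.1) (fun i => i.1.2.2) x.2 (show 0 < ε / 4 by linarith)
    exact ⟨⟨q, hq⟩, fun i hi => (hq' ⟨i, hi⟩).trans (by linarith)⟩
  · intro s ε hε y
    obtain ⟨p, hp, hp'⟩ := hF.exists_mem_limitLayer hz (t := fun i : s => i.1.1.1)
      (fun i => i.1.2.1) (fun i => i.1.2.2) y.2 (show 0 < ε / 4 by linarith)
    exact ⟨⟨p, hp⟩, fun i hi => (hp' ⟨i, hi⟩).trans (by linarith)⟩

theorem remainder_nonempty : (remainder ℝ≥0).Nonempty :=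
  (remainder_inter_nonempty isClosed_univ
    (Eventually.of_forall fun _ => ⟨0, mem_univ _⟩).frequently).left

end Layer

end StandardContinuum

end

theorem mainTheorem3
    (hCH : Cardinal.aleph 1 = (Cardinal.continuum : Cardinal.{0}))
    (u : Ultrafilter ℕ) (hu : ∀ n : ℕ, u ≠ pure n)
    (a : ℕ → StoneCech StandardContinuum.Mspace)
    (hcut : ∀ n, StandardContinuum.IsCutPoint u (a n))
    (hmono : ∀ m n, m < n → StandardContinuum.lt u (a m) (a n)) :
    (∃! L, StandardContinuum.IsSupremumLayer u a L) ∧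
      ∀ L, StandardContinuum.IsSupremumLayer u a L →
        Nonempty (L ≃ₜ StandardContinuum.remainder ℝ≥0) := by
  obtain ⟨z, hz, hL⟩ :=
    StandardContinuum.exists_isSupremumLayer_iff (fun n => (hcut n).1) hmono
  obtain ⟨e⟩ := StandardContinuum.nonempty_limitLayer_homeomorph hCH hu hz
  obtain ⟨q, hq⟩ := StandardContinuum.remainder_nonempty
  refine ⟨⟨_, (hL _).2 ⟨rfl, (e.symm ⟨q, hq⟩).1, (e.symm ⟨q, hq⟩).2⟩,
    fun L h => ((hL L).1 h).1⟩, fun L h => ?_⟩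
  rw [((hL L).1 h).1]
  exact ⟨e⟩
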